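/- Let $n\ge 1$, $0<\alpha<n$, $0<q<\infty$, and let $1<r,s<\infty$ satisfy $\frac1r+\frac1s=1$. For measurable $f,g:\mathbb R^n\to\mathbb C$ put $$\mathsf{BI}_\alpha(f,g)(x)=\int_{\mathbb R^n}\frac{f(x-y)\,g(x+y)}{|y|^{n-\alpha}}\,dy,\qquad \mathcal M_\alpha^{r,s}(f,g)(x)=\sup_{Q\ni x}|Q|^{\frac{\alpha}{n}}\Bigl(\frac1{|Q|}\int_Q|f|^r\Bigr)^{\frac1r}\Bigl(\frac1{|Q|}\int_Q|g|^s\Bigr)^{\frac1s}\in[0,\infty],$$ where the supremum is over all cubes $Q\subset\mathbb R^n$ with sides parallel to the axes that contain $x$ (with the convention $0\cdot\infty=0$). Let $w$ be a weight, i.e. a locally integrable function on $\mathbb R^n$ with $w>0$ almost everywhere, and suppose $w\in A_\infty=\bigcup_{p>1}A_p$, where $w\in A_p$ means $$\sup_Q\Bigl(\frac1{|Q|}\int_Q w\Bigr)\Bigl(\frac1{|Q|}\int_Q w^{1-p'}\Bigr)^{p-1}<\infty,\qquad p'=\frac{p}{p-1}.$$ Then there is a finite constant $C$, independent of $f$ and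 $g$, such that for all measurable $f,g$ $$\int_{\mathbb R^n}|\mathsf{BI}_\alpha(f,g)(x)|^q\,w(x)\,dx\le C\int_{\mathbb R^n}\mathcal M_\alpha^{r,s}(f,g)(x)^q\,w(x)\,dx .$$ If the right-hand side is finite, then the integral defining $\mathsf{BI}_\alpha(f,g)(x)$ converges absolutely for almost every $x$, so that the left-hand side is meaningful; if it is infinite, the inequality asserts nothing. -/

import Mathlib

open MeasureTheory
open scoped ENNReal NNReal

noncomputable section

namespace BilinearFractional

/-- The half-open cube with sides parallel to the axes, lower corner `a` and side length `l`.
(Averages, and the suprema over all cubes below, are the same for open or closed cubes.) -/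
def cube {n : ℕ} (a : EuclideanSpace ℝ (Fin n)) (l : ℝ) : Set (EuclideanSpace ℝ (Fin n)) :=
  {x | ∀ i, x i ∈ Set.Ico (a i) (a i + l)}

/-- The integrand `y ↦ f (x - y) g (x + y) / |y| ^ (n - α)`. -/
def integrand {n : ℕ} (α : ℝ) (f g : EuclideanSpace ℝ (Fin n) → ℂ)
    (x y : EuclideanSpace ℝ (Fin n)) : ℂ :=
  f (x - y) * g (x + y) / ((‖y‖ ^ ((n : ℝ) - α) : ℝ) : ℂ)

/-- The bilinear fractional integral `BI_α (f, g) (x)`. -/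
def BI {n : ℕ} (α : ℝ) (f g : EuclideanSpace ℝ (Fin n) → ℂ)
    (x : EuclideanSpace ℝ (Fin n)) : ℂ :=
  ∫ y, integrand α f g x y

/-- The maximal operator
`sup_{Q ∋ x} |Q| ^ (α / n) (⨍_Q |f| ^ r) ^ (1 / r) (⨍_Q |g| ^ s) ^ (1 / s)`,
the supremum over all cubes `Q` containing `x`, with values in `[0, ∞]`. -/
def maximal {n : ℕ} (α r s : ℝ) (f g : EuclideanSpace ℝ (Fin n) → ℂ)
    (x : EuclideanSpace ℝ (Fin n)) : ℝ≥0∞ :=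
  ⨆ (a : EuclideanSpace ℝ (Fin n)) (l : ℝ) (_ : 0 < l) (_ : x ∈ cube a l),
    volume (cube a l) ^ (α / n) *
      (⨍⁻ y in cube a l, ‖f y‖ₑ ^ r ∂volume) ^ (1 / r) * (⨍⁻ y in cube a l, ‖g y‖ₑ ^ s ∂volume) ^ (1 / s)

/-- A weight: a locally integrable function that is positive almost everywhere. -/
structure IsWeight {n : ℕ} (w : EuclideanSpace ℝ (Fin n) → ℝ) : Prop where
  locallyIntegrable : LocallyIntegrable w volume
  pos : ∀ᵐ x, 0 < w x

/-- The Muckenhoupt class `A_p`, for `1 < p`: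
`sup_Q (⨍_Q w) (⨍_Q w ^ (1 - p')) ^ (p - 1) < ∞`, where `p' = p / (p - 1)`. -/
def MemAp {n : ℕ} (p : ℝ) (w : EuclideanSpace ℝ (Fin n) → ℝ) : Prop :=
  IsWeight w ∧ ∃ K : ℝ≥0, ∀ (a : EuclideanSpace ℝ (Fin n)) (l : ℝ), 0 < l →
    (⨍⁻ x in cube a l, ENNReal.ofReal (w x) ∂volume) *
      (⨍⁻ x in cube a l, ENNReal.ofReal (w x) ^ (1 - p.conjExponent) ∂volume) ^ (p - 1) ≤ K

/-- The class `A_∞`, the union of all `A_p` with `1 < p`. -/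
def MemAinfty {n : ℕ} (w : EuclideanSpace ℝ (Fin n) → ℝ) : Prop :=
  ∃ p : ℝ, 1 < p ∧ MemAp p w

end BilinearFractional

end

noncomputable section

namespace BilinearFractional

/-! ### Dyadic cubes and their triples -/

section

variable {n : ℕ}

/-! Split the `y`-integral into shells `|y| ~ 2 ^ j`. There the kernel is about `2 ^ (α j) / 2 ^ (n
j)`, and both `x - y` and `x + y` lie in the triple `3Q` of the dyadic cube `Q` of side `2 ^ j`
around `x`. Hölder in `y`, with `1/r + 1/s = 1`, bounds the operator by a multiple of `∑ j, 2 ^ (α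
j) b_j(x)`, where `b_j = ‖f‖_{L^r(3Q)} ‖g‖_{L^s(3Q)} / |Q|` (`lintegral_enorm_integrand_le`). The
supremum over `j` of the same terms is at most `3 ^ n` times the maximal function
(`zpow_mul_dyadicAverage_le_maximal`). It remains to dominate the sum by the supremum in `L^q(w)`.

Let `Ω_k` be the set where some `b_j` exceeds `a ^ k`; it is the disjoint union of maximal dyadic
cubes `P`. The scales with `b_j > a ^ k` contribute a geometric series, so the sum is controlled by
`∑ k, levelSup k`, where `levelSup k` lives on `Ω_k`, is constant on the stopping cubes of every
level `l ≥ k`, and is at most the supremum.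

For large `a`, `|P ∩ Ω_{k+1}| ≤ |P| / 2` (`two_mul_volume_inter_levelSet_le`: Vitali covering plus
superadditivity of the norm product). The `A_∞` condition turns this into `w(P ∩ Ω_{k+1}) ≤ δ w(P)`
with `δ < 1`, and `w(P) ≤ M w(P \ Ω_{k+1})`. The first bound makes the integral of `levelSup k ^ q`
over `Ω_{k+m}` decay like `δ ^ m`; the second moves what is left to the disjoint sets `Ω_k \
Ω_{k+1}`, where it sums to the integral of the supremum (`lintegral_tsum_rpow_le`). Truncating `f`
and `g` supplies the qualitative finiteness needed on the way. -/

lemma cube_eq_preimage (a : EuclideanSpace ℝ (Fin n)) (l : ℝ) :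
    cube a l = WithLp.ofLp ⁻¹' (Set.univ.pi fun i => Set.Ico (a i) (a i + l)) := by
  ext x; simp [cube]

lemma measurableSet_cube (a : EuclideanSpace ℝ (Fin n)) (l : ℝ) : MeasurableSet (cube a l) := by
  rw [cube_eq_preimage]
  exact (PiLp.volume_preserving_ofLp (Fin n)).measurable
    (MeasurableSet.univ_pi fun i => measurableSet_Ico)

lemma volume_cube (a : EuclideanSpace ℝ (Fin n)) (l : ℝ) :
    volume (cube a l) = ENNReal.ofReal l ^ n := by
  rw [cube_eq_preimage, (PiLp.volume_preserving_ofLp (Fin n)).measure_preimage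
    (MeasurableSet.univ_pi fun i => measurableSet_Ico).nullMeasurableSet, Real.volume_pi_Ico]
  simp

/-- The integer coordinates of the dyadic cube of side `2 ^ j` that contains `x`. -/
def dyadicIndex (j : ℤ) (x : EuclideanSpace ℝ (Fin n)) : Fin n → ℤ := fun i => ⌊x i / 2 ^ j⌋

/-- The cube of side `t * 2 ^ j` with lower corner `2 ^ j * (m + c)`. -/
def gridCube (c t : ℝ) (j : ℤ) (m : Fin n → ℤ) : Set (EuclideanSpace ℝ (Fin n)) :=
  cube (WithLp.toLp 2 fun i => 2 ^ j * (m i + c)) (t * 2 ^ j)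

/-- The dyadic cube of side `2 ^ j` that contains `x`. -/
def dyadicCube (j : ℤ) (x : EuclideanSpace ℝ (Fin n)) : Set (EuclideanSpace ℝ (Fin n)) :=
  gridCube 0 1 j (dyadicIndex j x)

/-- The concentric triple of the dyadic cube of side `2 ^ j` that contains `x`. -/
def tripleCube (j : ℤ) (x : EuclideanSpace ℝ (Fin n)) : Set (EuclideanSpace ℝ (Fin n)) :=
  gridCube (-1) 3 j (dyadicIndex j x)

lemma mem_gridCube {c t : ℝ} {j : ℤ} {m : Fin n → ℤ} {x : EuclideanSpace ℝ (Fin n)} :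
    x ∈ gridCube c t j m ↔ ∀ i, 2 ^ j * (m i + c) ≤ x i ∧ x i < 2 ^ j * (m i + c + t) := by
  simp only [gridCube, cube, Set.mem_ofPred_eq, Set.mem_Ico]
  refine forall_congr' fun i => and_congr_right fun _ => ?_
  rw [show (2:ℝ) ^ j * (m i + c + t) = 2 ^ j * (m i + c) + t * 2 ^ j by ring]

lemma measurableSet_gridCube (c t : ℝ) (j : ℤ) (m : Fin n → ℤ) :
    MeasurableSet (gridCube c t j m) := measurableSet_cube _ _

lemma volume_gridCube (c t : ℝ) (j : ℤ) (m : Fin n → ℤ) :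
    volume (gridCube c t j m) = ENNReal.ofReal (t * 2 ^ j) ^ n := volume_cube _ _

lemma mem_gridCube_zero_one {j : ℤ} {m : Fin n → ℤ} {x : EuclideanSpace ℝ (Fin n)} :
    x ∈ gridCube 0 1 j m ↔ dyadicIndex j x = m := by
  rw [mem_gridCube, funext_iff]
  refine forall_congr' fun i => ?_
  have h : (0:ℝ) < 2 ^ j := by positivity
  rw [dyadicIndex, Int.floor_eq_iff, le_div_iff₀ h, div_lt_iff₀ h]
  simp [mul_comm]

lemma mem_dyadicCube {j : ℤ} {x y : EuclideanSpace ℝ (Fin n)} :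
    y ∈ dyadicCube j x ↔ dyadicIndex j y = dyadicIndex j x := mem_gridCube_zero_one

lemma self_mem_dyadicCube (j : ℤ) (x : EuclideanSpace ℝ (Fin n)) : x ∈ dyadicCube j x :=
  mem_dyadicCube.2 rfl

lemma measurable_dyadicIndex (j : ℤ) :
    Measurable (dyadicIndex j : EuclideanSpace ℝ (Fin n) → Fin n → ℤ) := by
  refine measurable_pi_iff.2 fun i => Int.measurable_floor.comp ?_
  exact (by fun_prop : Continuous fun x : EuclideanSpace ℝ (Fin n) => x i / 2 ^ j).measurable

lemma dyadicIndex_eq_of_le {i j : ℤ} (hij : i ≤ j) {x y : EuclideanSpace ℝ (Fin n)}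
    (h : dyadicIndex i y = dyadicIndex i x) : dyadicIndex j y = dyadicIndex j x := by
  obtain ⟨k, rfl⟩ := Int.le.dest hij
  have key : ∀ z : EuclideanSpace ℝ (Fin n), ∀ l,
      dyadicIndex (i + k) z l = dyadicIndex i z l / ((2 ^ k : ℕ) : ℤ) := fun z l => by
    rw [dyadicIndex, dyadicIndex, ← Int.floor_div_natCast, zpow_add₀ two_ne_zero, div_div]
    simp
  funext l
  rw [key, key, h]

lemma dyadicCube_eq_of_mem {i j : ℤ} (hij : i ≤ j) {x y : EuclideanSpace ℝ (Fin n)}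
    (h : y ∈ dyadicCube i x) : dyadicCube j y = dyadicCube j x := by
  rw [dyadicCube, dyadicIndex_eq_of_le hij (mem_dyadicCube.1 h), dyadicCube]

lemma tripleCube_eq_of_mem {i j : ℤ} (hij : i ≤ j) {x y : EuclideanSpace ℝ (Fin n)}
    (h : y ∈ dyadicCube i x) : tripleCube j y = tripleCube j x := by
  rw [tripleCube, dyadicIndex_eq_of_le hij (mem_dyadicCube.1 h), tripleCube]

lemma measurableSet_dyadicCube (j : ℤ) (x : EuclideanSpace ℝ (Fin n)) :
    MeasurableSet (dyadicCube j x) := measurableSet_gridCube _ _ _ _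

lemma measurableSet_tripleCube (j : ℤ) (x : EuclideanSpace ℝ (Fin n)) :
    MeasurableSet (tripleCube j x) := measurableSet_gridCube _ _ _ _

lemma dyadicIndex_bounds (j : ℤ) (x : EuclideanSpace ℝ (Fin n)) (i : Fin n) :
    (2:ℝ) ^ j * dyadicIndex j x i ≤ x i ∧ x i < 2 ^ j * dyadicIndex j x i + 2 ^ j := by
  have := mem_gridCube.1 (self_mem_dyadicCube j x) i
  simp only [add_zero, mul_add, mul_one] at this
  exact this

lemma mem_tripleCube {j : ℤ} {x y : EuclideanSpace ℝ (Fin n)} :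
    y ∈ tripleCube j x ↔ ∀ i, (2:ℝ) ^ j * dyadicIndex j x i - 2 ^ j ≤ y i ∧
      y i < 2 ^ j * dyadicIndex j x i + 2 * 2 ^ j := by
  rw [tripleCube, mem_gridCube]
  refine forall_congr' fun i => ?_
  rw [show (2:ℝ) ^ j * (dyadicIndex j x i + -1) = 2 ^ j * dyadicIndex j x i - 2 ^ j by ring,
    show (2:ℝ) ^ j * (dyadicIndex j x i + -1 + 3) = 2 ^ j * dyadicIndex j x i + 2 * 2 ^ j by ring]

lemma self_mem_tripleCube (j : ℤ) (x : EuclideanSpace ℝ (Fin n)) : x ∈ tripleCube j x := by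
  refine mem_tripleCube.2 fun i => ?_
  have := dyadicIndex_bounds j x i
  have h : (0:ℝ) < 2 ^ j := by positivity
  constructor <;> linarith

lemma tripleCube_mono {i j : ℤ} (hij : i ≤ j) (x : EuclideanSpace ℝ (Fin n)) :
    tripleCube i x ⊆ tripleCube j x := by
  rcases hij.eq_or_lt with rfl | hlt
  · rfl
  intro y hy
  rw [mem_tripleCube] at hy ⊢
  intro l
  have hi : (0:ℝ) < 2 ^ i := by positivity
  have h1 : (2:ℝ) ^ j ≥ 2 * 2 ^ i := by
    have : (2:ℝ) ^ (i + 1) ≤ 2 ^ j := zpow_le_zpow_right₀ one_le_two hlt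
    rw [zpow_add₀ two_ne_zero] at this
    linarith [zpow_one (2:ℝ)]
  have a := dyadicIndex_bounds i x l
  have b := dyadicIndex_bounds j x l
  have c := hy l
  constructor <;> linarith

end

/-! ### Sums over scales against suprema over scales -/

section

lemma tsum_int_eq_tsum_nat_sub {F : ℤ → ℝ≥0∞} {J : ℤ} (h : ∀ j, J < j → F j = 0) :
    ∑' j, F j = ∑' m : ℕ, F (J - m) := by
  have hinj : Function.Injective fun m : ℕ => J - (m : ℤ) := fun m m' h => by
    simpa using h
  refine (hinj.tsum_eq fun j hj => ?_).symm
  have : j ≤ J := not_lt.1 fun hlt => hj (h j hlt)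
  exact ⟨(J - j).toNat, by simp only; omega⟩

/-- The largest element of `T` gives the first term of a decreasing geometric series that dominates
the sum. -/
lemma tsum_indicator_zpow_le {c : ℝ≥0∞} (hc : 1 < c) (hc' : c ≠ ∞) {T : Set ℤ}
    (hT : BddAbove T) :
    ∑' j, T.indicator (fun j => c ^ j) j ≤ (1 - c⁻¹)⁻¹ * ⨆ j, T.indicator (fun j => c ^ j) j := by
  rcases T.eq_empty_or_nonempty with rfl | hne
  · simp
  obtain ⟨J, hJ, hJT⟩ := Int.exists_greatest_of_bdd (P := (· ∈ T)) hT hne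
  have hc0 : c ≠ 0 := (zero_lt_one.trans hc).ne'
  rw [tsum_int_eq_tsum_nat_sub (J := J) fun j hj =>
    Set.indicator_of_notMem (fun hjT => (hJT j hjT).not_gt hj) _]
  calc ∑' m : ℕ, T.indicator (fun j => c ^ j) (J - m) ≤ ∑' m : ℕ, c⁻¹ ^ m * c ^ J := by
        refine ENNReal.tsum_le_tsum fun m => (Set.indicator_le_self _ _ _).trans_eq ?_
        rw [ENNReal.zpow_sub hc0 hc', zpow_natCast, ENNReal.inv_pow, mul_comm]
    _ = (1 - c⁻¹)⁻¹ * c ^ J := by rw [ENNReal.tsum_mul_right, ENNReal.tsum_geometric]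
    _ ≤ _ := by
        gcongr
        exact (Set.indicator_of_mem hJ _).ge.trans (le_iSup (T.indicator (fun j => c ^ j)) J)

/-- Each `g m` is at most `θ ^ (m / q)` times the `q`-th root of the weighted sum, and these bounds
form a geometric series. All `q > 0` are covered without a split at `q = 1`. -/
lemma tsum_rpow_le {q : ℝ} (hq : 0 < q) {θ : ℝ≥0∞} (hθ : θ ≠ 0) (hθ' : θ ≠ ∞) (g : ℕ → ℝ≥0∞) :
    (∑' m, g m) ^ q ≤ ((1 - θ ^ (1 / q))⁻¹) ^ q * ∑' m, θ⁻¹ ^ m * g m ^ q := by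
  set S := ∑' m, θ⁻¹ ^ m * g m ^ q with hS
  have hg : ∀ m, g m ≤ (θ ^ (1 / q)) ^ m * S ^ (1 / q) := fun m => by
    have h1 : g m ^ q ≤ θ ^ m * S := by
      calc g m ^ q = θ ^ m * (θ⁻¹ ^ m * g m ^ q) := by
            rw [← mul_assoc, ← mul_pow, ENNReal.mul_inv_cancel hθ hθ', one_pow, one_mul]
        _ ≤ θ ^ m * S := by gcongr; exact ENNReal.le_tsum m
    calc g m = (g m ^ q) ^ (1 / q) := by
          rw [← ENNReal.rpow_mul, mul_one_div_cancel hq.ne', ENNReal.rpow_one]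
      _ ≤ (θ ^ m * S) ^ (1 / q) := ENNReal.rpow_le_rpow h1 (by positivity)
      _ = _ := by
          rw [ENNReal.mul_rpow_of_nonneg _ _ (by positivity), ← ENNReal.rpow_natCast,
            ← ENNReal.rpow_natCast, ← ENNReal.rpow_mul, ← ENNReal.rpow_mul, mul_comm (m : ℝ)]
  calc (∑' m, g m) ^ q ≤ (∑' m, (θ ^ (1 / q)) ^ m * S ^ (1 / q)) ^ q :=
        ENNReal.rpow_le_rpow (ENNReal.tsum_le_tsum hg) hq.le
    _ = _ := by
        rw [ENNReal.tsum_mul_right, ENNReal.tsum_geometric,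
          ENNReal.mul_rpow_of_nonneg _ _ hq.le, ← ENNReal.rpow_mul (x := S),
          one_div_mul_cancel hq.ne', ENNReal.rpow_one]

variable {n : ℕ}

/-- A family of functions, the `j`-th of which is constant on dyadic cubes of side `2 ^ j`. -/
def IsDyadic {β : Type*} (b : ℤ → EuclideanSpace ℝ (Fin n) → β) : Prop :=
  ∀ j x y, y ∈ dyadicCube j x → b j y = b j x

lemma IsDyadic.measurable {β : Type*} [MeasurableSpace β]
    {b : ℤ → EuclideanSpace ℝ (Fin n) → β} (hb : IsDyadic b) (j : ℤ) : Measurable (b j) := by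
  intro s _
  have : b j ⁻¹' s = dyadicIndex j ⁻¹' (dyadicIndex j '' (b j ⁻¹' s)) := by
    refine (Set.subset_preimage_image _ _).antisymm ?_
    rintro y ⟨x, hx, hxy⟩
    rw [Set.mem_preimage, hb j x y (mem_dyadicCube.2 hxy.symm)]
    exact hx
  rw [this]
  exact measurable_dyadicIndex j (MeasurableSet.of_discrete)

/-- The set where some `b j` exceeds `a ^ k`. -/
def levelSet (a : ℝ≥0∞) (b : ℤ → EuclideanSpace ℝ (Fin n) → ℝ≥0∞) (k : ℤ) :
    Set (EuclideanSpace ℝ (Fin n)) := {x | ∃ j, a ^ k < b j x}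

/-- `a ^ k` times the largest `c ^ j` for which `b j x` exceeds `a ^ k`. -/
def levelSup (a c : ℝ≥0∞) (b : ℤ → EuclideanSpace ℝ (Fin n) → ℝ≥0∞) (k : ℤ)
    (x : EuclideanSpace ℝ (Fin n)) : ℝ≥0∞ :=
  a ^ k * ⨆ j, {j | a ^ k < b j x}.indicator (fun j => c ^ j) j

/-- The maximal dyadic cubes on which `b j` exceeds `a ^ k`. -/
def stoppingCubes (a : ℝ≥0∞) (b : ℤ → EuclideanSpace ℝ (Fin n) → ℝ≥0∞) (k : ℤ) :
    Set (Set (EuclideanSpace ℝ (Fin n))) :=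
  {P | ∃ j x, P = dyadicCube j x ∧ a ^ k < b j x ∧ ∀ i, j < i → b i x ≤ a ^ k}

section

variable {a c : ℝ≥0∞} {b : ℤ → EuclideanSpace ℝ (Fin n) → ℝ≥0∞}

lemma measurableSet_levelSet (hb : IsDyadic b) (k : ℤ) : MeasurableSet (levelSet a b k) := by
  have : levelSet a b k = ⋃ j, b j ⁻¹' Set.Ioi (a ^ k) := by ext; simp [levelSet]
  rw [this]
  exact MeasurableSet.iUnion fun j => hb.measurable j measurableSet_Ioi

lemma levelSet_anti (ha : 1 ≤ a) {k l : ℤ} (h : k ≤ l) : levelSet a b l ⊆ levelSet a b k :=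
  fun _ ⟨j, hj⟩ => ⟨j, (ENNReal.zpow_le_of_le ha h).trans_lt hj⟩

lemma measurable_levelSup (hb : IsDyadic b) (k : ℤ) : Measurable (levelSup a c b k) := by
  refine (Measurable.iSup fun j => ?_).const_mul _
  have : (fun x => {j | a ^ k < b j x}.indicator (fun j => c ^ j) j) =
      (b j ⁻¹' Set.Ioi (a ^ k)).indicator fun _ => c ^ j := by
    ext x; simp [Set.indicator]
  rw [this]
  exact measurable_const.indicator (hb.measurable j measurableSet_Ioi)

lemma levelSup_le (k : ℤ) (x : EuclideanSpace ℝ (Fin n)) :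
    levelSup a c b k x ≤ ⨆ j, c ^ j * b j x := by
  rw [levelSup, ENNReal.mul_iSup]
  refine iSup_mono fun j => ?_
  by_cases h : a ^ k < b j x
  · rw [Set.indicator_of_mem (by exact h), mul_comm]
    gcongr
  · rw [Set.indicator_of_notMem (by exact h)]
    simp

lemma levelSup_eq_zero {k : ℤ} {x : EuclideanSpace ℝ (Fin n)} (hx : x ∉ levelSet a b k) :
    levelSup a c b k x = 0 := by
  have : {j | a ^ k < b j x} = ∅ := Set.eq_empty_of_forall_notMem fun j hj => hx ⟨j, hj⟩
  simp [levelSup, this]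

/-- Let `P` have side `2 ^ J`. For scales `j ≥ J`, `b j` is constant on `P`; a scale `j ≤ J` can be
replaced by `J`, because `b J > a ^ l ≥ a ^ k` on `P` and `c ^ j ≤ c ^ J`. By symmetry `levelSup` is
constant on `P`. -/
lemma levelSup_le_of_mem_stoppingCubes (hb : IsDyadic b) (ha : 1 ≤ a) (hc : 1 ≤ c) {k l : ℤ}
    (hkl : k ≤ l) {P : Set (EuclideanSpace ℝ (Fin n))} (hP : P ∈ stoppingCubes a b l)
    {x y : EuclideanSpace ℝ (Fin n)} (hx : x ∈ P) (hy : y ∈ P) :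
    levelSup a c b k x ≤ levelSup a c b k y := by
  obtain ⟨J, z, rfl, hJ, -⟩ := hP
  unfold levelSup
  gcongr _ * ?_
  refine iSup_le fun j => ?_
  by_cases h : a ^ k < b j x
  swap
  · rw [Set.indicator_of_notMem (by exact h)]
    simp
  rw [Set.indicator_of_mem (by exact h)]
  rcases le_total J j with hj | hj
  · have : b j y = b j x := hb j x y <| by
      rw [dyadicCube_eq_of_mem hj hx, ← dyadicCube_eq_of_mem hj hy]
      exact self_mem_dyadicCube _ _
    refine le_iSup_of_le j ?_
    rw [Set.indicator_of_mem (by simpa [this] using h)]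
  · refine le_iSup_of_le J ?_
    rw [Set.indicator_of_mem]
    · exact ENNReal.zpow_le_of_le hc hj
    · rw [Set.mem_ofPred_eq, hb J z y hy]
      exact (ENNReal.zpow_le_of_le ha hkl).trans_lt hJ

lemma countable_stoppingCubes (k : ℤ) : (stoppingCubes a b k).Countable := by
  refine (Set.countable_range fun p : ℤ × (Fin n → ℤ) => gridCube 0 1 p.1 p.2).mono ?_
  rintro _ ⟨j, x, rfl, -⟩
  exact ⟨(j, dyadicIndex j x), rfl⟩

lemma measurableSet_of_mem_stoppingCubes {k : ℤ} {P : Set (EuclideanSpace ℝ (Fin n))}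
    (hP : P ∈ stoppingCubes a b k) : MeasurableSet P := by
  obtain ⟨j, x, rfl, -⟩ := hP
  exact measurableSet_dyadicCube j x

lemma pairwiseDisjoint_stoppingCubes (hb : IsDyadic b) (k : ℤ) :
    (stoppingCubes a b k).PairwiseDisjoint id := by
  have key : ∀ {j x z}, z ∈ dyadicCube j x → a ^ k < b j x → (∀ i, j < i → b i x ≤ a ^ k) →
      dyadicCube j x = dyadicCube j z ∧ a ^ k < b j z ∧ ∀ i, j < i → b i z ≤ a ^ k := by
    intro j x z hz h1 h2
    refine ⟨(dyadicCube_eq_of_mem le_rfl hz).symm, by rwa [hb j x z hz], fun i hi => ?_⟩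
    rw [hb i x z]
    · exact h2 i hi
    · rw [← dyadicCube_eq_of_mem hi.le hz]
      exact self_mem_dyadicCube _ _
  intro P hP P' hP' hne
  refine Set.disjoint_left.2 fun z hz hz' => hne ?_
  obtain ⟨j, x, rfl, h1, h2⟩ := hP
  obtain ⟨j', x', rfl, h1', h2'⟩ := hP'
  obtain ⟨e, h1, h2⟩ := key hz h1 h2
  obtain ⟨e', h1', h2'⟩ := key hz' h1' h2'
  rcases lt_trichotomy j j' with h | h | h
  · exact absurd h1' (h2 _ h).not_gt
  · rw [e, e', h]
  · exact absurd h1 (h2' _ h).not_gt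

lemma biUnion_stoppingCubes (hb : IsDyadic b) (hbdd : ∀ (k : ℤ) x, BddAbove {j | a ^ k < b j x})
    (k : ℤ) : ⋃ P ∈ stoppingCubes a b k, P = levelSet a b k := by
  ext x
  simp only [Set.mem_iUnion, exists_prop]
  constructor
  · rintro ⟨_, ⟨j, y, rfl, h, -⟩, hx⟩
    exact ⟨j, by rwa [hb j y x hx]⟩
  · intro hx
    obtain ⟨J, hJ, hJT⟩ := Int.exists_greatest_of_bdd (hbdd k x) hx
    exact ⟨_, ⟨J, x, rfl, hJ, fun i hi => not_lt.1 fun h => (hJT i h).not_gt hi⟩,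
      self_mem_dyadicCube _ _⟩

/-- Since `H` is constant on each stopping cube, the integrals reduce to the measure comparison cube
by cube. It serves both the decay in `m` and the passage to `Ω_k \ Ω_{k+1}`. -/
lemma setLIntegral_levelSet_inter_le (hb : IsDyadic b)
    (hbdd : ∀ (k : ℤ) x, BddAbove {j | a ^ k < b j x}) {ν : Measure (EuclideanSpace ℝ (Fin n))}
    {k : ℤ} {A B : Set (EuclideanSpace ℝ (Fin n))} (hA : MeasurableSet A) (hB : MeasurableSet B)
    {δ : ℝ≥0∞} (hAB : ∀ P ∈ stoppingCubes a b k, ν (P ∩ A) ≤ δ * ν (P ∩ B))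
    {H : EuclideanSpace ℝ (Fin n) → ℝ≥0∞}
    (hH : ∀ P ∈ stoppingCubes a b k, ∀ x ∈ P, ∀ y ∈ P, H x = H y) :
    ∫⁻ x in levelSet a b k ∩ A, H x ∂ν ≤ δ * ∫⁻ x in levelSet a b k ∩ B, H x ∂ν := by
  have key : ∀ {A}, MeasurableSet A → ∫⁻ x in levelSet a b k ∩ A, H x ∂ν =
      ∑' P : stoppingCubes a b k, ∫⁻ x in P ∩ A, H x ∂ν := by
    intro A hA
    rw [← biUnion_stoppingCubes hb hbdd, Set.iUnion₂_inter]
    refine lintegral_biUnion (countable_stoppingCubes k)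
      (fun P hP => (measurableSet_of_mem_stoppingCubes hP).inter hA)
      ((pairwiseDisjoint_stoppingCubes hb k).mono_on fun P _ => Set.inter_subset_left) _
  rw [key hA, key hB, ← ENNReal.tsum_mul_left]
  refine ENNReal.tsum_le_tsum fun ⟨P, hP⟩ => ?_
  rcases P.eq_empty_or_nonempty with rfl | ⟨z, hz⟩
  · simp
  have hc : ∀ {A}, MeasurableSet A → ∫⁻ x in P ∩ A, H x ∂ν = H z * ν (P ∩ A) := by
    intro A hA
    rw [setLIntegral_congr_fun (g := fun _ => H z)
      ((measurableSet_of_mem_stoppingCubes hP).inter hA) fun x hx => hH P hP x hx.1 z hz,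
      setLIntegral_const]
  simp only [hc hA, hc hB]
  rw [mul_left_comm]
  gcongr
  exact hAB P hP

lemma tsum_zpow_mul_le_tsum_levelSup (ha : 1 < a) (ha' : a ≠ ∞) (hc : 1 < c) (hc' : c ≠ ∞)
    {x : EuclideanSpace ℝ (Fin n)} (hfin : ∀ j, b j x ≠ ∞)
    (hbdd : ∀ (k : ℤ) x, BddAbove {j | a ^ k < b j x}) :
    ∑' j, c ^ j * b j x ≤ a * (1 - c⁻¹)⁻¹ * ∑' k, levelSup a c b k x := by
  have ha0 : a ≠ 0 := (zero_lt_one.trans ha).ne'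
  calc ∑' j, c ^ j * b j x
      ≤ ∑' j, ∑' k : ℤ, a * (a ^ k * {j | a ^ k < b j x}.indicator (fun j => c ^ j) j) := by
        refine ENNReal.tsum_le_tsum fun j => ?_
        rcases eq_or_ne (b j x) 0 with h0 | h0
        · simp [h0]
        -- One level suffices: the `k` with `a ^ k < b j x ≤ a ^ (k + 1)`, at the cost of the factor
        -- `a`.
        obtain ⟨k, hk⟩ := ENNReal.exists_mem_Ioc_zpow h0 (hfin j) ha ha'
        refine le_trans ?_ (ENNReal.le_tsum k)
        rw [Set.indicator_of_mem (by exact hk.1)]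
        calc c ^ j * b j x ≤ c ^ j * a ^ (k + 1) := by gcongr; exact hk.2
          _ = a * (a ^ k * c ^ j) := by rw [ENNReal.zpow_add ha0 ha', zpow_one]; ring
    _ = a * ∑' k : ℤ, a ^ k * ∑' j, {j | a ^ k < b j x}.indicator (fun j => c ^ j) j := by
        rw [ENNReal.tsum_comm]
        simp_rw [ENNReal.tsum_mul_left]
    _ ≤ a * ∑' k, (1 - c⁻¹)⁻¹ * levelSup a c b k x := by
        refine mul_le_mul_right (ENNReal.tsum_le_tsum fun k => ?_) _
        rw [levelSup, mul_left_comm]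
        gcongr
        exact tsum_indicator_zpow_le hc hc' (hbdd k x)
    _ = _ := by rw [ENNReal.tsum_mul_left, mul_assoc]

lemma tsum_levelSup_rpow_le (ha : 1 < a) {q : ℝ} (hq : 0 < q) {θ : ℝ≥0∞} (hθ : θ ≠ 0)
    (hθ' : θ ≠ ∞) {x : EuclideanSpace ℝ (Fin n)} (hL : ∃ K : ℤ, ∀ j, b j x ≤ a ^ K) :
    (∑' k, levelSup a c b k x) ^ q ≤ ((1 - θ ^ (1 / q))⁻¹) ^ q *
      ∑' m : ℕ, ∑' k : ℤ, θ⁻¹ ^ m *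
        (levelSet a b (k + m)).indicator (fun x => levelSup a c b k x ^ q) x := by
  by_cases hx : ∃ k, x ∈ levelSet a b k
  swap
  · have : ∀ k, levelSup a c b k x = 0 := fun k => levelSup_eq_zero fun h => hx ⟨k, h⟩
    simp [this, hq]
  obtain ⟨K₀, hK₀⟩ := hL
  -- Let `K` be the top level at `x`. The remaining levels are `k = K - m`, and `x` lies in the
  -- level set of index `k + m = K`, which selects one `k` for each `m`.
  obtain ⟨K, hK, hKT⟩ := Int.exists_greatest_of_bdd (P := fun k => x ∈ levelSet a b k)
    ⟨K₀, fun k ⟨j, hj⟩ => not_lt.1 fun hlt =>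
      (hj.trans_le (hK₀ j)).not_ge (ENNReal.zpow_le_of_le ha.le hlt.le)⟩ hx
  rw [tsum_int_eq_tsum_nat_sub (J := K) fun k hk =>
    levelSup_eq_zero fun h => (hKT k h).not_gt hk]
  refine (tsum_rpow_le hq hθ hθ' _).trans ?_
  gcongr with m
  refine le_trans ?_ (ENNReal.le_tsum (K - m))
  rw [Set.indicator_of_mem (by simpa using hK)]

/-- Each passage from level `k + m` to `k + m + 1` costs a factor `δ`, because `levelSup k` is
constant on the stopping cubes of level `k + m`. -/
lemma setLIntegral_levelSup_le (hb : IsDyadic b) (ha : 1 ≤ a) (hc : 1 ≤ c)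
    (hbdd : ∀ (k : ℤ) x, BddAbove {j | a ^ k < b j x}) {ν : Measure (EuclideanSpace ℝ (Fin n))}
    {δ : ℝ≥0∞}
    (hν : ∀ k, ∀ P ∈ stoppingCubes a b k, ν (P ∩ levelSet a b (k + 1)) ≤ δ * ν P)
    (q : ℝ) (k : ℤ) (m : ℕ) :
    ∫⁻ x in levelSet a b (k + m), levelSup a c b k x ^ q ∂ν ≤
      δ ^ m * ∫⁻ x in levelSet a b k, levelSup a c b k x ^ q ∂ν := by
  induction m with
  | zero => simp
  | succ m ih =>
    have h := setLIntegral_levelSet_inter_le hb hbdd (ν := ν) (k := k + m) (δ := δ)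
      (measurableSet_levelSet hb (k + m + 1)) MeasurableSet.univ
      (by simpa using hν (k + m)) (H := fun x => levelSup a c b k x ^ q)
      fun P hP x hx y hy => by
        rw [(levelSup_le_of_mem_stoppingCubes hb ha hc (by simp) hP hx hy).antisymm
          (levelSup_le_of_mem_stoppingCubes hb ha hc (by simp) hP hy hx)]
    rw [Set.inter_univ, Set.inter_eq_right.2 (levelSet_anti ha (by simp))] at h
    rw [Nat.cast_succ, ← add_assoc]
    refine h.trans ?_
    rw [pow_succ', mul_assoc]
    gcongr

lemma tsum_setLIntegral_le (hb : IsDyadic b) (ha : 1 ≤ a)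
    (ν : Measure (EuclideanSpace ℝ (Fin n))) (H : EuclideanSpace ℝ (Fin n) → ℝ≥0∞) :
    ∑' k, ∫⁻ x in levelSet a b k \ levelSet a b (k + 1), H x ∂ν ≤ ∫⁻ x, H x ∂ν := by
  rw [← lintegral_iUnion
    (fun k => (measurableSet_levelSet hb k).diff (measurableSet_levelSet hb (k + 1)))]
  · exact setLIntegral_le_lintegral _ _
  · intro k l hkl
    wlog h : k < l generalizing k l
    · exact (this hkl.symm (lt_of_le_of_ne (not_lt.1 h) hkl.symm)).symm
    exact Set.disjoint_left.2 fun x hx hx' => hx.2 (levelSet_anti ha h hx'.1)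

end

/-- The dyadic Coifman inequality: a sum over scales is controlled by the supremum over scales. -/
theorem lintegral_tsum_rpow_le {q : ℝ} (hq : 0 < q) {a c δ M : ℝ≥0∞} (ha : 1 < a) (ha' : a ≠ ∞)
    (hc : 1 < c) (hc' : c ≠ ∞) (hδ : δ < 1) (hM : M ≠ ∞) :
    ∃ C : ℝ≥0∞, C ≠ ∞ ∧ ∀ (ν : Measure (EuclideanSpace ℝ (Fin n)))
      (b : ℤ → EuclideanSpace ℝ (Fin n) → ℝ≥0∞), IsDyadic b →
      (∀ (k : ℤ) x, BddAbove {j | a ^ k < b j x}) → (∃ K : ℤ, ∀ j x, b j x ≤ a ^ K) →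
      (∀ k, ∀ P ∈ stoppingCubes a b k, ν (P ∩ levelSet a b (k + 1)) ≤ δ * ν P ∧
        ν P ≤ M * ν (P \ levelSet a b (k + 1))) →
      ∫⁻ x, (∑' j, c ^ j * b j x) ^ q ∂ν ≤ C * ∫⁻ x, (⨆ j, c ^ j * b j x) ^ q ∂ν := by
  -- `θ < 1` makes the series in `tsum_rpow_le` converge, and `δ < θ` lets the decay `δ ^ m` absorb
  -- the weight `θ⁻¹ ^ m`.
  obtain ⟨θ, hδθ, hθ1⟩ := exists_between hδ
  have hθ0 : θ ≠ 0 := (zero_le.trans_lt hδθ).ne'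
  have hθt : θ ≠ ∞ := (hθ1.trans ENNReal.one_lt_top).ne
  set A := (a * (1 - c⁻¹)⁻¹) ^ q with hA
  set B := ((1 - θ ^ (1 / q))⁻¹) ^ q with hB
  have hAt : A ≠ ∞ := by
    refine ENNReal.rpow_ne_top_of_nonneg hq.le (ENNReal.mul_ne_top ha' ?_)
    exact ENNReal.inv_ne_top.2 (tsub_pos_of_lt (ENNReal.inv_lt_one.2 hc)).ne'
  have hBt : B ≠ ∞ := by
    refine ENNReal.rpow_ne_top_of_nonneg hq.le (ENNReal.inv_ne_top.2 ?_)
    exact (tsub_pos_of_lt (ENNReal.rpow_lt_one hθ1 (by positivity))).ne'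
  have hGt : (1 - θ⁻¹ * δ)⁻¹ ≠ ∞ := by
    refine ENNReal.inv_ne_top.2 (tsub_pos_of_lt ?_).ne'
    rw [mul_comm, ← div_eq_mul_inv]
    exact ENNReal.div_lt_of_lt_mul (by rwa [one_mul])
  refine ⟨A * (B * ((1 - θ⁻¹ * δ)⁻¹ * M)), by finiteness, fun ν b hb hbdd hL hν => ?_⟩
  have hfin : ∀ j x, b j x ≠ ∞ := fun j x => by
    obtain ⟨K, hK⟩ := hL
    exact ((hK j x).trans_lt (ENNReal.zpow_lt_top (zero_lt_one.trans ha).ne' ha' K)).ne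
  have hmeas : ∀ k, Measurable fun x => levelSup a c b k x ^ q := fun k =>
    (measurable_levelSup hb k).pow_const q
  have hdiff : ∀ k, ∫⁻ x in levelSet a b k, levelSup a c b k x ^ q ∂ν ≤
      M * ∫⁻ x in levelSet a b k \ levelSet a b (k + 1), (⨆ j, c ^ j * b j x) ^ q ∂ν := by
    intro k
    have h := setLIntegral_levelSet_inter_le hb hbdd (ν := ν) (k := k) (δ := M)
      MeasurableSet.univ (measurableSet_levelSet hb (k + 1)).compl
      (by simpa [← Set.sdiff_eq] using fun P hP => (hν k P hP).2)
      (H := fun x => levelSup a c b k x ^ q) fun P hP x hx y hy => by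
        rw [(levelSup_le_of_mem_stoppingCubes hb ha.le hc.le le_rfl hP hx hy).antisymm
          (levelSup_le_of_mem_stoppingCubes hb ha.le hc.le le_rfl hP hy hx)]
    rw [Set.inter_univ, ← Set.sdiff_eq] at h
    refine h.trans ?_
    gcongr with x
    exact levelSup_le k x
  calc ∫⁻ x, (∑' j, c ^ j * b j x) ^ q ∂ν
      ≤ ∫⁻ x, A * (B * ∑' m : ℕ, ∑' k : ℤ, θ⁻¹ ^ m *
        (levelSet a b (k + m)).indicator (fun x => levelSup a c b k x ^ q) x) ∂ν := by
        refine lintegral_mono fun x => ?_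
        refine (ENNReal.rpow_le_rpow (tsum_zpow_mul_le_tsum_levelSup ha ha' hc hc'
          (fun j => hfin j x) hbdd) hq.le).trans ?_
        rw [ENNReal.mul_rpow_of_nonneg _ _ hq.le]
        gcongr
        exact tsum_levelSup_rpow_le ha hq hθ0 hθt (hL.imp fun K h j => h j x)
    _ = A * (B * ∑' m : ℕ, ∑' k : ℤ, θ⁻¹ ^ m *
        ∫⁻ x in levelSet a b (k + m), levelSup a c b k x ^ q ∂ν) := by
        have hm : ∀ (m : ℕ) (k : ℤ), Measurable
            ((levelSet a b (k + m)).indicator (fun x => levelSup a c b k x ^ q)) := fun m k =>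
          (hmeas k).indicator (measurableSet_levelSet hb _)
        have hm' : ∀ (m : ℕ), Measurable fun x => ∑' k : ℤ, θ⁻¹ ^ m *
            ((levelSet a b (k + m)).indicator (fun x => levelSup a c b k x ^ q)) x := fun m =>
          Measurable.tsum fun k => (hm m k).const_mul _
        rw [lintegral_const_mul _ ((Measurable.tsum hm').const_mul _),
          lintegral_const_mul _ (Measurable.tsum hm'),
          lintegral_tsum fun m => (hm' m).aemeasurable]
        congr 3 with m
        rw [lintegral_tsum fun k => ((hm m k).const_mul _).aemeasurable]
        congr 1 with k
        rw [lintegral_const_mul _ (hm m k), lintegral_indicator (measurableSet_levelSet hb _)]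
    _ ≤ A * (B * ∑' m : ℕ, ∑' k : ℤ, (θ⁻¹ * δ) ^ m *
        (M * ∫⁻ x in levelSet a b k \ levelSet a b (k + 1), (⨆ j, c ^ j * b j x) ^ q ∂ν)) := by
        refine mul_le_mul_right (mul_le_mul_right (ENNReal.tsum_le_tsum fun m =>
          ENNReal.tsum_le_tsum fun k => ?_) _) _
        rw [mul_pow, mul_assoc]
        gcongr
        refine (setLIntegral_levelSup_le hb ha.le hc.le hbdd
          (fun k P hP => (hν k P hP).1) q k m).trans ?_
        gcongr
        exact hdiff k
    _ ≤ _ := by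
        simp_rw [ENNReal.tsum_mul_left, ENNReal.tsum_mul_right, ENNReal.tsum_geometric, mul_assoc]
        gcongr
        exact tsum_setLIntegral_le hb ha.le ν _

end

/-! ### Averages over tripled cubes and sparseness of the stopping cubes -/

section

lemma tsum_rpow_mul_rpow_le {ι : Type*} {r s : ℝ} (hrs : r.HolderConjugate s)
    (A B : ι → ℝ≥0∞) :
    ∑' i, A i ^ (1 / r) * B i ^ (1 / s) ≤ (∑' i, A i) ^ (1 / r) * (∑' i, B i) ^ (1 / s) := by
  rw [ENNReal.tsum_eq_iSup_sum]
  refine iSup_le fun t => (ENNReal.inner_le_Lp_mul_Lq t _ _ hrs).trans ?_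
  have h : ∀ {p : ℝ}, 0 < p → ∀ x : ℝ≥0∞, (x ^ (1 / p)) ^ p = x := fun hp x => by
    rw [← ENNReal.rpow_mul, one_div_mul_cancel hp.ne', ENNReal.rpow_one]
  simp_rw [h hrs.pos, h hrs.symm.pos]
  have hr := hrs.pos
  have hs := hrs.symm.pos
  gcongr <;> exact ENNReal.sum_le_tsum t

variable {n : ℕ}

lemma ofReal_two_zpow (j : ℤ) : ENNReal.ofReal ((2:ℝ) ^ j) = 2 ^ j := by
  have h : (2:ℝ) ^ j = (((2:ℝ≥0) ^ j : ℝ≥0) : ℝ) := by simp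
  rw [h, ENNReal.ofReal_coe_nnreal, ENNReal.coe_zpow two_ne_zero]
  simp

lemma volume_gridCube' {c t : ℝ} (ht : 0 ≤ t) (j : ℤ) (m : Fin n → ℤ) :
    volume (gridCube c t j m) = ENNReal.ofReal t ^ n * (2 ^ j) ^ n := by
  rw [volume_gridCube, ENNReal.ofReal_mul ht, ofReal_two_zpow, mul_pow]

lemma volume_dyadicCube (j : ℤ) (x : EuclideanSpace ℝ (Fin n)) :
    volume (dyadicCube j x) = (2 ^ j) ^ n := by
  rw [dyadicCube, volume_gridCube' zero_le_one]
  simp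

lemma volume_tripleCube (j : ℤ) (x : EuclideanSpace ℝ (Fin n)) :
    volume (tripleCube j x) = 3 ^ n * (2 ^ j) ^ n := by
  rw [tripleCube, volume_gridCube' (by norm_num)]
  simp

/-- The product of the `L ^ r` norm of `u` and the `L ^ s` norm of `v` on `A`. -/
def normProd (r s : ℝ) (u v : EuclideanSpace ℝ (Fin n) → ℝ≥0∞)
    (A : Set (EuclideanSpace ℝ (Fin n))) : ℝ≥0∞ :=
  (∫⁻ y in A, u y ^ r) ^ (1 / r) * (∫⁻ y in A, v y ^ s) ^ (1 / s)

/-- The norms of `u` and `v` on the tripled dyadic cube, normalized by the volume. -/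
def dyadicAverage (r s : ℝ) (u v : EuclideanSpace ℝ (Fin n) → ℝ≥0∞) (j : ℤ)
    (x : EuclideanSpace ℝ (Fin n)) : ℝ≥0∞ :=
  normProd r s u v (tripleCube j x) / (2 ^ j) ^ n

lemma two_zpow_pow_ne_zero (j : ℤ) (n : ℕ) : ((2:ℝ≥0∞) ^ j) ^ n ≠ 0 :=
  pow_ne_zero _ (ENNReal.zpow_pos two_ne_zero ENNReal.ofNat_ne_top j).ne'

lemma two_zpow_pow_ne_top (j : ℤ) (n : ℕ) : ((2:ℝ≥0∞) ^ j) ^ n ≠ ∞ :=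
  ENNReal.pow_ne_top (ENNReal.zpow_ne_top two_ne_zero ENNReal.ofNat_ne_top j)

lemma isDyadic_dyadicAverage (r s : ℝ) (u v : EuclideanSpace ℝ (Fin n) → ℝ≥0∞) :
    IsDyadic (dyadicAverage r s u v) := fun j x y h => by
  rw [dyadicAverage, dyadicAverage, tripleCube_eq_of_mem le_rfl h]

section

variable {r s : ℝ} {u v : EuclideanSpace ℝ (Fin n) → ℝ≥0∞}

lemma normProd_mono (hrs : r.HolderConjugate s) {A B : Set (EuclideanSpace ℝ (Fin n))}
    (h : A ⊆ B) : normProd r s u v A ≤ normProd r s u v B := by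
  have hr := hrs.pos
  have hs := hrs.symm.pos
  unfold normProd
  gcongr

/-- Hölder for sums with `1/r + 1/s = 1` makes `normProd` superadditive over disjoint sets; it thus
replaces a measure in the weak-type argument. -/
lemma tsum_normProd_le (hrs : r.HolderConjugate s) {ι : Type*} {t : Set ι} (ht : t.Countable)
    {B : ι → Set (EuclideanSpace ℝ (Fin n))} (hB : ∀ i ∈ t, MeasurableSet (B i))
    (hd : t.PairwiseDisjoint B) :
    ∑' i : t, normProd r s u v (B i) ≤ normProd r s u v (⋃ i ∈ t, B i) := by
  refine (tsum_rpow_mul_rpow_le hrs _ _).trans_eq ?_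
  rw [normProd, lintegral_biUnion ht hB hd, lintegral_biUnion ht hB hd]

/-- In a stopping cube, the set of the next level has at most half of the volume. -/
lemma two_mul_volume_inter_levelSet_le (hrs : r.HolderConjugate s) (k : ℤ)
    {P : Set (EuclideanSpace ℝ (Fin n))}
    (hP : P ∈ stoppingCubes (2 * 22 ^ n) (dyadicAverage r s u v) k) :
    2 * volume (P ∩ levelSet (2 * 22 ^ n) (dyadicAverage r s u v) (k + 1)) ≤ volume P := by
  -- In `22 = 11 * 2`, the `11` is the Vitali enlargement and the `2` the passage to the dyadic
  -- parent; the leading `2` yields one half of the volume.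
  set a : ℝ≥0∞ := 2 * 22 ^ n with ha
  have ha1 : 1 ≤ a := one_le_mul one_le_two (one_le_pow₀ (by norm_num))
  have ha0 : a ≠ 0 := (zero_lt_one.trans_le ha1).ne'
  have hat : a ≠ ∞ := by finiteness
  obtain ⟨j, x, rfl, -, hmax⟩ := hP
  set b := dyadicAverage r s u v with hb
  have hbP : ∀ {i y}, y ∈ dyadicCube j x → j < i → b i y ≤ a ^ k := fun {i y} hy hi => by
    rw [hb, isDyadic_dyadicAverage r s u v i x y]
    · exact hmax i hi
    · rw [← dyadicCube_eq_of_mem hi.le hy]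
      exact self_mem_dyadicCube _ _
  let t : Set (ℤ × (Fin n → ℤ)) := {p | p.1 ≤ j ∧ ∃ y ∈ dyadicCube j x,
    p.2 = dyadicIndex p.1 y ∧ a ^ (k + 1) < b p.1 y}
  obtain ⟨U, hUt, hUd, hU⟩ := Vitali.exists_disjoint_subfamily_covering_enlargement
    (fun p : ℤ × (Fin n → ℤ) => (gridCube (-1) 3 p.1 p.2 : Set (EuclideanSpace ℝ (Fin n)))) t
    (fun p => (2:ℝ) ^ p.1) 2 one_lt_two (fun p _ => by positivity) (2 ^ j)
    (fun p hp => zpow_le_zpow_right₀ one_le_two hp.1)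
    (fun p hp => by
      obtain ⟨-, y, -, h, -⟩ := hp
      rw [h]
      exact ⟨y, self_mem_tripleCube _ _⟩)
  have hUc : U.Countable := Set.to_countable U
  -- The triple of a cube of side `2 ^ i ≤ 2 * 2 ^ p.1` meets the triple of `p`, so its points `y`
  -- are within `2 * 2 ^ i ≤ 4 * 2 ^ p.1` of that triple in each coordinate: side `3 + 4 + 4 = 11`,
  -- corner `-1 - 4 = -5`.
  have hcover : dyadicCube j x ∩ levelSet a b (k + 1) ⊆ ⋃ p ∈ U, gridCube (-5) 11 p.1 p.2 := by
    rintro y ⟨hy, i, hi⟩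
    have hij : i ≤ j := not_lt.1 fun hlt =>
      (hi.trans_le (hbP hy hlt)).not_ge (ENNReal.zpow_le_of_le ha1 (by simp))
    obtain ⟨p, hp, ⟨z, hz, hz'⟩, hle⟩ := hU (i, dyadicIndex i y) ⟨hij, y, hy, rfl, hi⟩
    refine Set.mem_biUnion hp (mem_gridCube.2 fun l => ?_)
    have h1 := mem_gridCube.1 hz' l
    have h2 := mem_tripleCube.1 (show z ∈ tripleCube i y from hz) l
    have h3 := dyadicIndex_bounds i y l
    simp only at hle
    constructor <;> linarith [h1.1, h1.2, h2.1, h2.2, h3.1, h3.2]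
  have hsum : ∑' p : U, normProd r s u v (gridCube (-1) 3 p.1.1 p.1.2) ≤
      a ^ k * (2 ^ n * (2 ^ j) ^ n) := by
    refine (tsum_normProd_le hrs hUc (fun p _ => measurableSet_gridCube _ _ _ _) hUd).trans ?_
    -- All selected triples lie in the triple of the dyadic parent, where maximality of the stopping
    -- cube bounds the average by `a ^ k`.
    have hsub : ⋃ p ∈ U, gridCube (-1) 3 p.1 p.2 ⊆ tripleCube (j + 1) x := by
      refine Set.iUnion₂_subset fun p hp => ?_
      obtain ⟨hpj, y, hy, h, -⟩ := hUt hp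
      rw [h, ← tripleCube_eq_of_mem (by simp) hy]
      exact tripleCube_mono (by omega) y
    refine (normProd_mono hrs hsub).trans ?_
    have := hmax (j + 1) (by simp)
    rw [hb, dyadicAverage, ENNReal.div_le_iff (two_zpow_pow_ne_zero _ _)
      (two_zpow_pow_ne_top _ _), ENNReal.zpow_add two_ne_zero ENNReal.ofNat_ne_top, zpow_one,
      mul_pow, mul_comm (_ ^ n) (_ ^ n)] at this
    exact this
  have hU' : ∀ p : U, a ^ (k + 1) * (2 ^ p.1.1) ^ n ≤
      normProd r s u v (gridCube (-1) 3 p.1.1 p.1.2) := by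
    rintro ⟨p, hp⟩
    obtain ⟨-, y, -, h, hlt⟩ := hUt hp
    have := hlt.le
    rw [hb, dyadicAverage, ENNReal.le_div_iff_mul_le (Or.inl (two_zpow_pow_ne_zero _ _))
      (Or.inl (two_zpow_pow_ne_top _ _))] at this
    rw [h]
    exact this
  have hmain : a ^ k * (a * volume (dyadicCube j x ∩ levelSet a b (k + 1))) ≤
      a ^ k * (22 ^ n * (2 ^ j) ^ n) := by
    calc a ^ k * (a * volume (dyadicCube j x ∩ levelSet a b (k + 1)))
        ≤ a ^ (k + 1) * ∑' p : U, 11 ^ n * (2 ^ p.1.1) ^ n := by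
          rw [← mul_assoc, ENNReal.zpow_add ha0 hat, zpow_one]
          gcongr
          refine (measure_mono hcover).trans ((measure_biUnion_le _ hUc _).trans_eq ?_)
          simp_rw [volume_gridCube' (show (0:ℝ) ≤ 11 by norm_num)]
          simp
      _ = 11 ^ n * ∑' p : U, a ^ (k + 1) * (2 ^ p.1.1) ^ n := by
          rw [ENNReal.tsum_mul_left, ENNReal.tsum_mul_left]
          ring
      _ ≤ 11 ^ n * (a ^ k * (2 ^ n * (2 ^ j) ^ n)) := by
          gcongr
          exact (ENNReal.tsum_le_tsum hU').trans hsum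
      _ = _ := by
          rw [show (22:ℝ≥0∞) = 11 * 2 by norm_num, mul_pow]
          ring
  rw [ENNReal.mul_le_mul_iff_right (ENNReal.zpow_pos ha0 hat k).ne'
    (ENNReal.zpow_ne_top ha0 hat k)] at hmain
  nth_rewrite 1 [ha] at hmain
  rw [mul_comm 2, mul_assoc, ENNReal.mul_le_mul_iff_right (by positivity) (by finiteness)] at hmain
  rwa [volume_dyadicCube]

lemma dyadicAverage_le (hrs : r.HolderConjugate s) {L : ℝ≥0∞} (hu : ∀ x, u x ≤ L)
    (hv : ∀ x, v x ≤ L) (j : ℤ) (x : EuclideanSpace ℝ (Fin n)) :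
    dyadicAverage r s u v j x ≤ 3 ^ n * (L * L) := by
  have key : ∀ {p : ℝ}, 0 < p → ∀ {f : EuclideanSpace ℝ (Fin n) → ℝ≥0∞}, (∀ x, f x ≤ L) →
      (∫⁻ y in tripleCube j x, f y ^ p) ^ (1 / p) ≤
        L * (3 ^ n * (2 ^ j) ^ n) ^ (1 / p) := by
    intro p hp f hf
    calc (∫⁻ y in tripleCube j x, f y ^ p) ^ (1 / p)
        ≤ (∫⁻ y in tripleCube j x, L ^ p) ^ (1 / p) := by gcongr; exact hf _
      _ = _ := by
        rw [setLIntegral_const, volume_tripleCube, ENNReal.mul_rpow_of_nonneg _ _ (by positivity),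
          ← ENNReal.rpow_mul, mul_one_div_cancel hp.ne', ENNReal.rpow_one]
  rw [dyadicAverage, ENNReal.div_le_iff (two_zpow_pow_ne_zero _ _) (two_zpow_pow_ne_top _ _)]
  refine (mul_le_mul' (key hrs.pos hu) (key hrs.symm.pos hv)).trans_eq ?_
  have h : (3 ^ n * ((2:ℝ≥0∞) ^ j) ^ n) ^ (1 / r) * (3 ^ n * ((2:ℝ≥0∞) ^ j) ^ n) ^ (1 / s) =
      3 ^ n * (2 ^ j) ^ n := by
    rw [← ENNReal.rpow_add_of_nonneg _ _ hrs.one_div_nonneg hrs.symm.one_div_nonneg,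
      hrs.one_div_add_one_div, div_one, ENNReal.rpow_one]
  rw [mul_mul_mul_comm, h]
  ring

/-- The numerator is at most the finite global norm product, while the volumes of the cubes grow
without bound as `n ≠ 0`. -/
lemma bddAbove_lt_dyadicAverage (hn : n ≠ 0) (hrs : r.HolderConjugate s)
    (hu : normProd r s u v Set.univ ≠ ∞) {a : ℝ≥0∞} (ha : a ≠ 0) (ha' : a ≠ ∞)
    (x : EuclideanSpace ℝ (Fin n)) : BddAbove {j | a < dyadicAverage r s u v j x} := by
  obtain ⟨N, hN⟩ := ENNReal.exists_nat_gt (ENNReal.div_ne_top hu ha)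
  refine ⟨N, fun j hj => not_lt.1 fun hlt => ?_⟩
  have h1 : a * (2 ^ j) ^ n < normProd r s u v Set.univ := by
    refine lt_of_lt_of_le ?_ (normProd_mono hrs (Set.subset_univ (tripleCube j x)))
    exact (ENNReal.lt_div_iff_mul_lt (Or.inl (two_zpow_pow_ne_zero _ _))
      (Or.inl (two_zpow_pow_ne_top _ _))).1 hj
  have h2 : (N : ℝ≥0∞) ≤ (2 ^ j) ^ n := by
    calc (N : ℝ≥0∞) ≤ 2 ^ N := by exact_mod_cast N.lt_two_pow_self.le
      _ ≤ 2 ^ j := by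
        rw [← zpow_natCast]
        exact ENNReal.zpow_le_of_le one_le_two hlt.le
      _ ≤ (2 ^ j) ^ n := le_self_pow₀ (by
        rw [← zpow_zero (2:ℝ≥0∞)]
        exact ENNReal.zpow_le_of_le one_le_two (by omega)) hn
  have h3 : normProd r s u v Set.univ ≤ N * a :=
    (ENNReal.div_le_iff_le_mul (Or.inl ha) (Or.inl ha')).1 hN.le
  refine h1.not_ge (h3.trans ?_)
  rw [mul_comm]
  gcongr

end

end

/-! ### Consequences of the `A_∞` condition -/

section

variable {n : ℕ} {w : EuclideanSpace ℝ (Fin n) → ℝ}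

/-- The measure with density `w`. -/
def weightMeasure (w : EuclideanSpace ℝ (Fin n) → ℝ) : Measure (EuclideanSpace ℝ (Fin n)) :=
  volume.withDensity fun x => ENNReal.ofReal (w x)

lemma IsWeight.aemeasurable (hw : IsWeight w) : AEMeasurable (fun x => ENNReal.ofReal (w x)) :=
  hw.locallyIntegrable.aestronglyMeasurable.aemeasurable.ennreal_ofReal

lemma exists_isCompact_cube_subset (a : EuclideanSpace ℝ (Fin n)) (l : ℝ) :
    ∃ K, IsCompact K ∧ cube a l ⊆ K := by
  refine ⟨_, (isCompact_univ_pi fun i => isCompact_Icc (a := a i) (b := a i + l)).image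
    (PiLp.continuous_toLp 2 _), fun x hx => ⟨WithLp.ofLp x, fun i _ => ?_, rfl⟩⟩
  exact ⟨(hx i).1, (hx i).2.le⟩

lemma IsWeight.weightMeasure_cube_ne_top (hw : IsWeight w) (a : EuclideanSpace ℝ (Fin n))
    (l : ℝ) : weightMeasure w (cube a l) ≠ ∞ := by
  obtain ⟨K, hK, hsub⟩ := exists_isCompact_cube_subset a l
  rw [weightMeasure, withDensity_apply _ (measurableSet_cube a l)]
  refine ne_top_of_le_ne_top (hw.locallyIntegrable.integrableOn_isCompact hK).2.ne ?_
  exact (lintegral_mono_set hsub).trans (lintegral_mono fun x => Real.ofReal_le_enorm _)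

/-- Hölder applied to `1 = w ^ (1 / p) * w ^ (-(1 / p))`, valid almost everywhere on `F`. -/
lemma IsWeight.volume_rpow_le (hw : IsWeight w) {p : ℝ} (hp : 1 < p)
    (F : Set (EuclideanSpace ℝ (Fin n))) :
    volume F ^ p ≤ (∫⁻ x in F, ENNReal.ofReal (w x)) *
      (∫⁻ x in F, ENNReal.ofReal (w x) ^ (1 - p.conjExponent)) ^ (p - 1) := by
  have hpp := Real.HolderConjugate.conjExponent hp
  set p' := p.conjExponent
  have hp0 := hpp.pos
  have hp0' := hpp.symm.pos
  have hae : ∀ᵐ x ∂(volume.restrict F), (1:ℝ≥0∞) =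
      ENNReal.ofReal (w x) ^ (1 / p) * ENNReal.ofReal (w x) ^ (-(1 / p)) := by
    filter_upwards [ae_restrict_of_ae hw.pos] with x hx
    rw [← ENNReal.rpow_add _ _ (by simpa using hx) (by simp)]
    simp
  have h1 : volume F ≤ (∫⁻ x in F, ENNReal.ofReal (w x)) ^ (1 / p) *
      (∫⁻ x in F, ENNReal.ofReal (w x) ^ (1 - p')) ^ (1 / p') := by
    calc volume F = ∫⁻ x in F, ENNReal.ofReal (w x) ^ (1 / p) *
          ENNReal.ofReal (w x) ^ (-(1 / p)) := by
          rw [← lintegral_congr_ae hae, setLIntegral_one]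
      _ ≤ _ := ENNReal.lintegral_mul_le_Lp_mul_Lq _ hpp
          (hw.aemeasurable.restrict.pow_const _) (hw.aemeasurable.restrict.pow_const _)
      _ = _ := by
          have e : -(1 / p) * p' = 1 - p' := by
            have := hpp.mul_eq_add
            field_simp
            linarith
          simp_rw [← ENNReal.rpow_mul, e, one_div_mul_cancel hp0.ne', ENNReal.rpow_one]
  refine (ENNReal.rpow_le_rpow h1 hp0.le).trans_eq ?_
  rw [ENNReal.mul_rpow_of_nonneg _ _ hp0.le, ← ENNReal.rpow_mul, ← ENNReal.rpow_mul,
    one_div_mul_cancel hp0.ne', ENNReal.rpow_one, one_div_mul_eq_div, hpp.div_conj_eq_sub_one]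

/-- A weight in `A_∞` is comparable on a cube and on a large subset of the cube. -/
lemma MemAinfty.exists_weightMeasure_le (hw : MemAinfty w) :
    ∃ M : ℝ≥0∞, M ≠ ∞ ∧ ∀ (a : EuclideanSpace ℝ (Fin n)) (l : ℝ), 0 < l → ∀ F ⊆ cube a l,
      MeasurableSet F → volume (cube a l) ≤ 2 * volume F →
        weightMeasure w (cube a l) ≤ M * weightMeasure w F := by
  obtain ⟨p, hp, hw, K, hK⟩ := hw
  have hp0 : 0 < p := by linarith
  refine ⟨K * 2 ^ p, by finiteness, fun a l hl F hF hFm hQF => ?_⟩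
  have hQ0 : volume (cube a l) ≠ 0 := by rw [volume_cube]; simp [hl]
  have hQt : volume (cube a l) ≠ ∞ := by rw [volume_cube]; finiteness
  have hF0 : volume F ≠ 0 := fun h => hQ0 (by simpa [h] using hQF)
  have hFt : volume F ≠ ∞ := ne_top_of_le_ne_top hQt (measure_mono hF)
  have hA : (∫⁻ x in cube a l, ENNReal.ofReal (w x)) *
      (∫⁻ x in cube a l, ENNReal.ofReal (w x) ^ (1 - p.conjExponent)) ^ (p - 1) ≤
        K * volume (cube a l) ^ p := by
    have h := hK a l hl
    rw [setLAverage_eq, setLAverage_eq, ENNReal.div_rpow_of_nonneg _ _ (by linarith),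
      ← ENNReal.mul_div_mul_comm (Or.inr (by finiteness)) (Or.inl hQt), ENNReal.div_le_iff
        (mul_ne_zero hQ0 (ENNReal.rpow_pos (pos_iff_ne_zero.2 hQ0) hQt).ne') (by finiteness)] at h
    have e : volume (cube a l) ^ p = volume (cube a l) * volume (cube a l) ^ (p - 1) := by
      conv_rhs => rw [← ENNReal.rpow_one (volume (cube a l)), ← ENNReal.rpow_mul, one_mul,
        ← ENNReal.rpow_add _ _ hQ0 hQt, add_sub_cancel]
    rwa [e]
  rw [weightMeasure, withDensity_apply _ (measurableSet_cube a l), withDensity_apply _ hFm]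
  set W := ∫⁻ x in cube a l, ENNReal.ofReal (w x)
  rw [← ENNReal.mul_le_mul_iff_left (ENNReal.rpow_pos (pos_iff_ne_zero.2 hF0) hFt).ne'
    (ENNReal.rpow_ne_top_of_nonneg hp0.le hFt)]
  -- Hölder on `F`, enlargement of the dual integral from `F` to the cube, the `A_p` bound there,
  -- and `|Q| ≤ 2 |F|` give the constant `K * 2 ^ p`.
  calc W * volume F ^ p
      ≤ W * ((∫⁻ x in F, ENNReal.ofReal (w x)) *
        (∫⁻ x in cube a l, ENNReal.ofReal (w x) ^ (1 - p.conjExponent)) ^ (p - 1)) := by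
        gcongr
        refine (hw.volume_rpow_le hp F).trans ?_
        have : 0 ≤ p - 1 := by linarith
        gcongr
    _ = (∫⁻ x in F, ENNReal.ofReal (w x)) * (W *
        (∫⁻ x in cube a l, ENNReal.ofReal (w x) ^ (1 - p.conjExponent)) ^ (p - 1)) := by ring
    _ ≤ (∫⁻ x in F, ENNReal.ofReal (w x)) * (K * (2 * volume F) ^ p) := by
        exact mul_le_mul_right (hA.trans (by gcongr)) _
    _ = _ := by
        rw [ENNReal.mul_rpow_of_nonneg _ _ hp0.le]
        ring

/-- The two `A_∞` comparisons on the complement and on a small subset of a cube. -/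
lemma MemAinfty.exists_weightMeasure_inter_le (hw : MemAinfty w) :
    ∃ M δ : ℝ≥0∞, M ≠ ∞ ∧ δ < 1 ∧ ∀ (j : ℤ) (x : EuclideanSpace ℝ (Fin n)),
      ∀ A, MeasurableSet A → 2 * volume (dyadicCube j x ∩ A) ≤ volume (dyadicCube j x) →
        weightMeasure w (dyadicCube j x ∩ A) ≤ δ * weightMeasure w (dyadicCube j x) ∧
        weightMeasure w (dyadicCube j x) ≤ M * weightMeasure w (dyadicCube j x \ A) := by
  obtain ⟨M, hM, h⟩ := hw.exists_weightMeasure_le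
  obtain ⟨p, -, hw, -⟩ := hw
  -- `Q \ A` carries at least the fraction `(M + 1)⁻¹` of the weight of `Q`, which leaves at most
  -- `δ` for `Q ∩ A`. Adding `1` keeps the inverse finite.
  refine ⟨M + 1, 1 - (M + 1)⁻¹, by finiteness, ?_, fun j x A hA hvol => ?_⟩
  · exact ENNReal.sub_lt_self ENNReal.one_ne_top one_ne_zero
      (ENNReal.inv_ne_zero.2 (by finiteness))
  set Q := dyadicCube j x with hQ
  have hQm : MeasurableSet Q := measurableSet_dyadicCube j x
  have hQt : volume Q ≠ ∞ := by
    rw [hQ, volume_dyadicCube]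
    exact two_zpow_pow_ne_top _ _
  have hνt : weightMeasure w Q ≠ ∞ := hw.weightMeasure_cube_ne_top _ _
  have hhalf : volume Q ≤ 2 * volume (Q \ A) := by
    have hadd := measure_inter_add_sdiff (μ := volume) Q hA
    refine (ENNReal.add_le_add_iff_left hQt).1 ?_
    calc volume Q + volume Q = 2 * volume (Q ∩ A) + 2 * volume (Q \ A) := by
          rw [← mul_add, hadd, two_mul]
      _ ≤ volume Q + 2 * volume (Q \ A) := by gcongr
  have h2 : weightMeasure w Q ≤ (M + 1) * weightMeasure w (Q \ A) :=
    (h _ _ (by positivity) _ Set.sdiff_subset (hQm.diff hA) hhalf).trans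
      (mul_le_mul' le_self_add le_rfl)
  refine ⟨?_, h2⟩
  have h3 : (M + 1)⁻¹ * weightMeasure w Q ≤ weightMeasure w (Q \ A) := by
    rw [mul_comm, ← div_eq_mul_inv]
    exact ENNReal.div_le_of_le_mul (by rwa [mul_comm])
  rw [ENNReal.sub_mul (fun _ _ => hνt), one_mul]
  refine ENNReal.le_sub_of_add_le_right (ENNReal.mul_ne_top (by simp) hνt) ?_
  calc weightMeasure w (Q ∩ A) + (M + 1)⁻¹ * weightMeasure w Q
      ≤ weightMeasure w (Q ∩ A) + weightMeasure w (Q \ A) := by gcongr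
    _ = weightMeasure w Q := measure_inter_add_sdiff Q hA

end

/-! ### Truncation and monotone convergence -/

section

lemma iSup_rpow {ι : Type*} (f : ι → ℝ≥0∞) {p : ℝ} (hp : 0 < p) :
    (⨆ i, f i) ^ p = ⨆ i, f i ^ p :=
  Monotone.map_iSup_of_continuousAt (f := fun x : ℝ≥0∞ => x ^ p)
    ENNReal.continuous_rpow_const.continuousAt (ENNReal.monotone_rpow_of_nonneg hp.le)
    (by simp [hp])

lemma iSup_mul_iSup_of_monotone {f g : ℕ → ℝ≥0∞} (hf : Monotone f) (hg : Monotone g) :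
    (⨆ i, f i) * ⨆ i, g i = ⨆ i, f i * g i := by
  refine le_antisymm ?_ (iSup_le fun i => mul_le_mul' (le_iSup f i) (le_iSup g i))
  rw [ENNReal.iSup_mul]
  refine iSup_le fun i => ?_
  rw [ENNReal.mul_iSup]
  refine iSup_le fun j => le_iSup_of_le (max i j) ?_
  exact mul_le_mul' (hf (le_max_left _ _)) (hg (le_max_right _ _))

lemma tsum_iSup_of_monotone {ι : Type*} {f : ι → ℕ → ℝ≥0∞} (hf : ∀ i, Monotone (f i)) :
    ∑' i, ⨆ N, f i N = ⨆ N, ∑' i, f i N := by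
  simp_rw [ENNReal.tsum_eq_iSup_sum, ENNReal.finsetSum_iSup_of_monotone hf]
  exact iSup_comm

variable {n : ℕ}

/-- The truncation of `u` to values at most `N` and to the ball of radius `N`. -/
def truncate (u : EuclideanSpace ℝ (Fin n) → ℝ≥0∞) (N : ℕ) :
    EuclideanSpace ℝ (Fin n) → ℝ≥0∞ :=
  (Metric.closedBall 0 N).indicator fun x => min (u x) N

lemma truncate_le (u : EuclideanSpace ℝ (Fin n) → ℝ≥0∞) (N : ℕ)
    (x : EuclideanSpace ℝ (Fin n)) : truncate u N x ≤ u x :=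
  (Set.indicator_le_self _ _ _).trans (min_le_left _ _)

lemma truncate_le_natCast (u : EuclideanSpace ℝ (Fin n) → ℝ≥0∞) (N : ℕ)
    (x : EuclideanSpace ℝ (Fin n)) : truncate u N x ≤ N :=
  (Set.indicator_le_self _ _ _).trans (min_le_right _ _)

lemma monotone_truncate (u : EuclideanSpace ℝ (Fin n) → ℝ≥0∞) (x : EuclideanSpace ℝ (Fin n)) :
    Monotone fun N => truncate u N x := fun N N' h => by
  refine (Set.indicator_le_indicator ?_).trans (Set.indicator_le_indicator_of_subset
    (Metric.closedBall_subset_closedBall (by exact_mod_cast h)) (fun _ => zero_le) x)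
  gcongr

lemma iSup_truncate (u : EuclideanSpace ℝ (Fin n) → ℝ≥0∞) (x : EuclideanSpace ℝ (Fin n)) :
    ⨆ N, truncate u N x = u x := by
  refine le_antisymm (iSup_le fun N => truncate_le u N x) ?_
  obtain ⟨N₀, hN₀⟩ := exists_nat_ge ‖x‖
  calc u x = ⨆ N : ℕ, min (u x) N := by
        rw [← inf_iSup_eq, ENNReal.iSup_natCast, inf_top_eq]
    _ ≤ ⨆ N, truncate u N x := by
        refine iSup_le fun N => le_iSup_of_le (max N N₀) ?_
        rw [truncate, Set.indicator_of_mem]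
        · gcongr
          exact le_max_left _ _
        · simpa using Or.inr hN₀

lemma AEMeasurable.truncate {u : EuclideanSpace ℝ (Fin n) → ℝ≥0∞} (hu : AEMeasurable u)
    (N : ℕ) : AEMeasurable (truncate u N) :=
  (hu.min aemeasurable_const).indicator Metric.isClosed_closedBall.measurableSet

lemma lintegral_truncate_rpow_ne_top (u : EuclideanSpace ℝ (Fin n) → ℝ≥0∞) (N : ℕ) {p : ℝ}
    (hp : 0 < p) : ∫⁻ x, truncate u N x ^ p ≠ ∞ := by
  refine ne_top_of_le_ne_top (b := (N : ℝ≥0∞) ^ p *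
    volume (Metric.closedBall (0 : EuclideanSpace ℝ (Fin n)) N)) ?_ ?_
  · exact ENNReal.mul_ne_top (by finiteness) measure_closedBall_lt_top.ne
  · rw [← lintegral_indicator_const Metric.isClosed_closedBall.measurableSet]
    refine lintegral_mono fun x => ?_
    rw [truncate]
    by_cases hx : x ∈ Metric.closedBall (0 : EuclideanSpace ℝ (Fin n)) N
    · rw [Set.indicator_of_mem hx, Set.indicator_of_mem hx]
      gcongr
      exact min_le_right _ _
    · simp [Set.indicator_of_notMem hx, hp]

section

variable {r s : ℝ} {u v : EuclideanSpace ℝ (Fin n) → ℝ≥0∞}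

lemma dyadicAverage_mono (hrs : r.HolderConjugate s) {u' v' : EuclideanSpace ℝ (Fin n) → ℝ≥0∞}
    (hu : ∀ x, u x ≤ u' x) (hv : ∀ x, v x ≤ v' x) (j : ℤ) (x : EuclideanSpace ℝ (Fin n)) :
    dyadicAverage r s u v j x ≤ dyadicAverage r s u' v' j x := by
  have hr := hrs.pos
  have hs := hrs.symm.pos
  unfold dyadicAverage normProd
  gcongr with y y
  · exact hu y
  · exact hv y

/-- Monotone convergence in each factor; the product of two increasing suprema is the supremum of
the products. -/
lemma dyadicAverage_eq_iSup (hrs : r.HolderConjugate s) (hu : AEMeasurable u)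
    (hv : AEMeasurable v) (j : ℤ) (x : EuclideanSpace ℝ (Fin n)) :
    dyadicAverage r s u v j x =
      ⨆ N, dyadicAverage r s (truncate u N) (truncate v N) j x := by
  have key : ∀ {p : ℝ}, 0 < p → ∀ {f : EuclideanSpace ℝ (Fin n) → ℝ≥0∞}, AEMeasurable f →
      (∫⁻ y in tripleCube j x, f y ^ p) ^ (1 / p) =
        ⨆ N, (∫⁻ y in tripleCube j x, truncate f N y ^ p) ^ (1 / p) := by
    intro p hp f hf
    rw [← iSup_rpow _ (by positivity), ← lintegral_iSup'
      (fun N => ((AEMeasurable.truncate hf N).pow_const p).restrict)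
      (Filter.Eventually.of_forall fun y N N' h =>
        ENNReal.rpow_le_rpow (monotone_truncate f y h) hp.le)]
    simp_rw [← iSup_rpow _ hp, iSup_truncate]
  have hmono : ∀ {p : ℝ}, 0 < p → ∀ f : EuclideanSpace ℝ (Fin n) → ℝ≥0∞,
      Monotone fun N => (∫⁻ y in tripleCube j x, truncate f N y ^ p) ^ (1 / p) := by
    intro p hp f N N' h
    simp only
    gcongr with y
    exact monotone_truncate f y h
  unfold dyadicAverage normProd
  rw [key hrs.pos hu, key hrs.symm.pos hv, iSup_mul_iSup_of_monotone (hmono hrs.pos u)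
    (hmono hrs.symm.pos v), ENNReal.iSup_div]

end

/-- The weighted inequality for the dyadic operators. -/
theorem MemAinfty.exists_lintegral_tsum_dyadicAverage_le (hn : n ≠ 0) {q r s : ℝ} (hq : 0 < q)
    (hrs : r.HolderConjugate s) {w : EuclideanSpace ℝ (Fin n) → ℝ} (hw : MemAinfty w)
    {c : ℝ≥0∞} (hc : 1 < c) (hc' : c ≠ ∞) :
    ∃ C : ℝ≥0∞, C ≠ ∞ ∧ ∀ u v : EuclideanSpace ℝ (Fin n) → ℝ≥0∞, AEMeasurable u →
      AEMeasurable v →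
      ∫⁻ x, (∑' j, c ^ j * dyadicAverage r s u v j x) ^ q ∂(weightMeasure w) ≤
        C * ∫⁻ x, (⨆ j, c ^ j * dyadicAverage r s u v j x) ^ q ∂(weightMeasure w) := by
  obtain ⟨M, δ, hM, hδ, hν⟩ := hw.exists_weightMeasure_inter_le
  have ha : (1:ℝ≥0∞) < 2 * 22 ^ n :=
    ENNReal.one_lt_two.trans_le (le_mul_of_one_le_right' (one_le_pow₀ (by norm_num)))
  have ha' : (2:ℝ≥0∞) * 22 ^ n ≠ ∞ := by finiteness
  have ha0 : (2:ℝ≥0∞) * 22 ^ n ≠ 0 := (zero_lt_one.trans ha).ne'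
  obtain ⟨C, hC, hmain⟩ := lintegral_tsum_rpow_le (n := n) hq ha ha' hc hc' hδ hM
  refine ⟨C, hC, fun u v hu hv => ?_⟩
  have hmono : ∀ j x, Monotone fun N =>
      c ^ j * dyadicAverage r s (truncate u N) (truncate v N) j x := fun j x N N' h =>
    mul_le_mul_right (dyadicAverage_mono hrs (fun y => monotone_truncate u y h)
      (fun y => monotone_truncate v y h) j x) _
  have hD : ∀ x, ∑' j, c ^ j * dyadicAverage r s u v j x =
      ⨆ N, ∑' j, c ^ j * dyadicAverage r s (truncate u N) (truncate v N) j x := by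
    intro x
    simp_rw [dyadicAverage_eq_iSup hrs hu hv, ENNReal.mul_iSup]
    exact tsum_iSup_of_monotone fun j => hmono j x
  conv_lhs => simp only [hD, iSup_rpow _ hq]
  rw [lintegral_iSup]
  rotate_left
  · exact fun N => (Measurable.tsum fun j =>
      ((isDyadic_dyadicAverage r s _ _).measurable j).const_mul _).pow_const q
  · exact fun N N' h x => ENNReal.rpow_le_rpow
      (ENNReal.tsum_le_tsum fun j => hmono j x h) hq.le
  -- The constant does not depend on `N`. Bounded support and bounded values give finite norms,
  -- hence a largest scale; bounded values also give a largest level.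
  refine iSup_le fun N => (hmain _ _ (isDyadic_dyadicAverage r s _ _) ?_ ?_ ?_).trans ?_
  · refine fun k x => bddAbove_lt_dyadicAverage hn hrs ?_ (ENNReal.zpow_pos ha0 ha' k).ne'
      (ENNReal.zpow_ne_top ha0 ha' k) x
    rw [normProd, Measure.restrict_univ]
    have h1 := lintegral_truncate_rpow_ne_top u N hrs.pos
    have h2 := lintegral_truncate_rpow_ne_top v N hrs.symm.pos
    exact ENNReal.mul_ne_top (ENNReal.rpow_ne_top_of_nonneg hrs.one_div_nonneg h1)
      (ENNReal.rpow_ne_top_of_nonneg hrs.symm.one_div_nonneg h2)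
  -- `N + 1` instead of `N` keeps the bound nonzero when `N = 0`.
  · obtain ⟨K, hK⟩ : ∃ K : ℤ, (3:ℝ≥0∞) ^ n * ((N + 1) * (N + 1)) ≤ (2 * 22 ^ n) ^ K := by
      obtain ⟨K, hK⟩ := ENNReal.exists_mem_Ioc_zpow (x := 3 ^ n * ((N + 1) * (N + 1)))
        (by positivity) (by finiteness) ha ha'
      exact ⟨K + 1, hK.2⟩
    refine ⟨K, fun j x => (dyadicAverage_le hrs (fun y => ?_) (fun y => ?_) j x).trans hK⟩
    · exact (truncate_le_natCast u N y).trans le_self_add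
    · exact (truncate_le_natCast v N y).trans le_self_add
  · intro k P hP
    have hvol := two_mul_volume_inter_levelSet_le hrs k hP
    obtain ⟨j, x, rfl, -⟩ := hP
    exact hν j x _ (measurableSet_levelSet (isDyadic_dyadicAverage r s _ _) _) hvol
  · exact mul_le_mul_right (lintegral_mono fun x => ENNReal.rpow_le_rpow (iSup_mono fun j =>
      mul_le_mul_right (dyadicAverage_mono hrs (truncate_le u N) (truncate_le v N) j x) _)
      hq.le) _

end

/-! ### Pointwise comparison with the bilinear operator and the maximal operator -/

section

variable {n : ℕ} {r s α : ℝ}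

lemma two_rpow_zpow (α : ℝ) (j : ℤ) : ((2:ℝ≥0∞) ^ α) ^ j = (2 ^ j) ^ α := by
  rw [← ENNReal.rpow_intCast, ← ENNReal.rpow_intCast, ← ENNReal.rpow_mul, ← ENNReal.rpow_mul,
    mul_comm]

lemma lintegral_mul_le_normProd (hrs : r.HolderConjugate s)
    {u v : EuclideanSpace ℝ (Fin n) → ℝ≥0∞} (hu : AEMeasurable u) (hv : AEMeasurable v)
    {A : Set (EuclideanSpace ℝ (Fin n))} (hA : MeasurableSet A) (x : EuclideanSpace ℝ (Fin n)) :
    ∫⁻ y, A.indicator u (x - y) * A.indicator v (x + y) ≤ normProd r s u v A := by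
  have hu' : AEMeasurable fun y => A.indicator u (x - y) :=
    (hu.indicator hA).comp_quasiMeasurePreserving
      (Measure.measurePreserving_sub_left volume x).quasiMeasurePreserving
  have hv' : AEMeasurable fun y => A.indicator v (x + y) :=
    (hv.indicator hA).comp_quasiMeasurePreserving
      (measurePreserving_add_left volume x).quasiMeasurePreserving
  refine (ENNReal.lintegral_mul_le_Lp_mul_Lq _ hrs hu' hv').trans_eq ?_
  have h : ∀ {p : ℝ}, 0 < p → ∀ f : EuclideanSpace ℝ (Fin n) → ℝ≥0∞,
      ∫⁻ y, A.indicator f y ^ p = ∫⁻ y in A, f y ^ p := by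
    intro p hp f
    rw [← lintegral_indicator hA]
    refine lintegral_congr fun y => ?_
    by_cases hy : y ∈ A <;> simp [hy, hp]
  rw [lintegral_sub_left_eq_self (fun y => A.indicator u y ^ r) x,
    lintegral_add_left_eq_self (fun y => A.indicator v y ^ s) x, h hrs.pos, h hrs.symm.pos,
    normProd]

/-- As `n - α > 0`, the kernel is at most its value at `|y| = 2 ^ (j - 1)`. -/
lemma enorm_kernel_le (hαn : α < n) {j : ℤ} {y : EuclideanSpace ℝ (Fin n)}
    (hy : 2 ^ j ≤ 2 * ‖y‖) :
    ‖(((‖y‖ ^ ((n : ℝ) - α) : ℝ) : ℂ))⁻¹‖ₑ ≤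
      ENNReal.ofReal (2 ^ ((n : ℝ) - α)) * ((2 ^ α) ^ j / (2 ^ j) ^ n) := by
  have h2 : (0:ℝ) < 2 ^ j := by positivity
  have hy0 : 0 < ‖y‖ := by linarith
  have hβ : 0 ≤ (n : ℝ) - α := by linarith
  have h1 : (‖y‖ ^ ((n : ℝ) - α))⁻¹ ≤
      2 ^ ((n : ℝ) - α) * (((2:ℝ) ^ j) ^ α / (2 ^ j) ^ n) := by
    have h3 : ((2:ℝ) ^ j) ^ ((n : ℝ) - α) ≤ 2 ^ ((n : ℝ) - α) * ‖y‖ ^ ((n : ℝ) - α) := by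
      rw [← Real.mul_rpow two_pos.le hy0.le]
      exact Real.rpow_le_rpow h2.le hy hβ
    have h4 : ((2:ℝ) ^ j) ^ α / (2 ^ j) ^ n = (((2:ℝ) ^ j) ^ ((n : ℝ) - α))⁻¹ := by
      rw [Real.rpow_sub h2, Real.rpow_natCast, inv_div]
    rw [h4, inv_le_iff_one_le_mul₀ (by positivity), mul_right_comm, ← div_eq_mul_inv,
      one_le_div (by positivity)]
    exact h3
  rw [← Complex.ofReal_inv, ← ofReal_norm, Complex.norm_real, Real.norm_of_nonneg
    (by positivity)]
  refine (ENNReal.ofReal_le_ofReal h1).trans_eq ?_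
  rw [ENNReal.ofReal_mul (by positivity), ENNReal.ofReal_div_of_pos (by positivity),
    ENNReal.ofReal_pow h2.le, ← ENNReal.ofReal_rpow_of_pos h2, ofReal_two_zpow, two_rpow_zpow]

lemma sub_mem_tripleCube {j : ℤ} {x y : EuclideanSpace ℝ (Fin n)} (hy : ‖y‖ < 2 ^ j) :
    x - y ∈ tripleCube j x := by
  refine mem_tripleCube.2 fun i => ?_
  have h1 := abs_le.1 ((PiLp.norm_apply_le y i).trans hy.le)
  have h2 := dyadicIndex_bounds j x i
  simp only [PiLp.sub_apply]
  constructor <;> linarith [h1.1, h1.2, h2.1, h2.2]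

lemma add_mem_tripleCube {j : ℤ} {x y : EuclideanSpace ℝ (Fin n)} (hy : ‖y‖ < 2 ^ j) :
    x + y ∈ tripleCube j x := by
  simpa using sub_mem_tripleCube (x := x) (y := -y) (by simpa using hy)

/-- The bilinear fractional integral is pointwise at most a sum of dyadic averages. -/
lemma lintegral_enorm_integrand_le (hαn : α < n) (hrs : r.HolderConjugate s)
    {f g : EuclideanSpace ℝ (Fin n) → ℂ} (hf : AEMeasurable f) (hg : AEMeasurable g)
    (x : EuclideanSpace ℝ (Fin n)) :
    ∫⁻ y, ‖integrand α f g x y‖ₑ ≤ ENNReal.ofReal (2 ^ ((n : ℝ) - α)) *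
      ∑' j, (2 ^ α) ^ j * dyadicAverage r s (fun y => ‖f y‖ₑ) (fun y => ‖g y‖ₑ) j x := by
  set u : EuclideanSpace ℝ (Fin n) → ℝ≥0∞ := fun y => ‖f y‖ₑ
  set v : EuclideanSpace ℝ (Fin n) → ℝ≥0∞ := fun y => ‖g y‖ₑ
  have hu : AEMeasurable u := hf.enorm
  have hv : AEMeasurable v := hg.enorm
  set K := ENNReal.ofReal (2 ^ ((n : ℝ) - α))
  let F : ℤ → EuclideanSpace ℝ (Fin n) → ℝ≥0∞ := fun j y =>
    (tripleCube j x).indicator u (x - y) * (tripleCube j x).indicator v (x + y)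
  have hF : ∀ j, AEMeasurable (F j) := fun j =>
    ((hu.indicator (measurableSet_tripleCube j x)).comp_quasiMeasurePreserving
      (Measure.measurePreserving_sub_left volume x).quasiMeasurePreserving).mul
    ((hv.indicator (measurableSet_tripleCube j x)).comp_quasiMeasurePreserving
      (measurePreserving_add_left volume x).quasiMeasurePreserving)
  have hpt : ∀ y, ‖integrand α f g x y‖ₑ ≤
      ∑' j, K * ((2 ^ α) ^ j / (2 ^ j) ^ n) * F j y := by
    intro y
    -- At `y = 0` the denominator is `0 ^ (n - α) = 0`, and division by zero makes the integrand
    -- `0`.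
    rcases eq_or_ne y 0 with rfl | hy
    · have : (0:ℝ) ^ ((n : ℝ) - α) = 0 := Real.zero_rpow (by linarith)
      simp [integrand, this]
    obtain ⟨i, hi⟩ := exists_mem_Ico_zpow (norm_pos_iff.2 hy) (one_lt_two (α := ℝ))
    refine le_trans ?_ (ENNReal.le_tsum (i + 1))
    have hFi : F (i + 1) y = ‖f (x - y)‖ₑ * ‖g (x + y)‖ₑ := by
      simp only [F]
      rw [Set.indicator_of_mem (sub_mem_tripleCube hi.2),
        Set.indicator_of_mem (add_mem_tripleCube hi.2)]
    rw [hFi, integrand, div_eq_mul_inv, enorm_mul, enorm_mul, mul_comm]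
    gcongr
    refine enorm_kernel_le hαn ?_
    rw [zpow_add₀ two_ne_zero, zpow_one, mul_comm]
    gcongr
    exact hi.1
  calc ∫⁻ y, ‖integrand α f g x y‖ₑ
      ≤ ∫⁻ y, ∑' j, K * ((2 ^ α) ^ j / (2 ^ j) ^ n) * F j y := lintegral_mono hpt
    _ = ∑' j, K * ((2 ^ α) ^ j / (2 ^ j) ^ n) * ∫⁻ y, F j y := by
        rw [lintegral_tsum fun j => (hF j).const_mul _]
        congr 1 with j
        rw [lintegral_const_mul'' _ (hF j)]
    _ ≤ ∑' j, K * ((2 ^ α) ^ j * dyadicAverage r s u v j x) := by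
        refine ENNReal.tsum_le_tsum fun j => ?_
        rw [mul_assoc, dyadicAverage, div_eq_mul_inv, div_eq_mul_inv, mul_right_comm,
          mul_assoc _ _ (_⁻¹)]
        gcongr
        exact lintegral_mul_le_normProd hrs hu hv (measurableSet_tripleCube j x) x
    _ = _ := ENNReal.tsum_mul_left

/-- The triple is itself an admissible cube in the supremum. Dividing by `|Q|` instead of `|3Q|`
costs `3 ^ n`, since the exponents `1/r` and `1/s` add up to `1`. -/
lemma zpow_mul_dyadicAverage_le_maximal (hn : n ≠ 0) (hα : 0 < α) (hrs : r.HolderConjugate s)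
    (f g : EuclideanSpace ℝ (Fin n) → ℂ) (j : ℤ) (x : EuclideanSpace ℝ (Fin n)) :
    (2 ^ α) ^ j * dyadicAverage r s (fun y => ‖f y‖ₑ) (fun y => ‖g y‖ₑ) j x ≤
      3 ^ n * maximal α r s f g x := by
  set Q := tripleCube j x with hQ
  have hV : volume Q = 3 ^ n * (2 ^ j) ^ n := volume_tripleCube j x
  have hV0 : volume Q ≠ 0 := by
    rw [hV]
    exact mul_ne_zero (by positivity) (two_zpow_pow_ne_zero j n)
  have hVt : volume Q ≠ ∞ := by
    rw [hV]
    exact ENNReal.mul_ne_top (by finiteness) (two_zpow_pow_ne_top j n)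
  have hmax : volume Q ^ (α / n) * (⨍⁻ y in Q, ‖f y‖ₑ ^ r ∂volume) ^ (1 / r) *
      (⨍⁻ y in Q, ‖g y‖ₑ ^ s ∂volume) ^ (1 / s) ≤ maximal α r s f g x :=
    le_iSup₂_of_le _ _ (le_iSup₂_of_le (by positivity) (self_mem_tripleCube j x) le_rfl)
  refine le_trans ?_ (mul_le_mul_right hmax _)
  have hpow : ((2:ℝ≥0∞) ^ α) ^ j ≤ volume Q ^ (α / n) := by
    have hn' : (n : ℝ) ≠ 0 := by exact_mod_cast hn
    calc ((2:ℝ≥0∞) ^ α) ^ j = ((2 ^ j) ^ n) ^ (α / n) := by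
          rw [two_rpow_zpow, ← ENNReal.rpow_natCast, ← ENNReal.rpow_mul, mul_div_cancel₀ _ hn']
      _ ≤ volume Q ^ (α / n) := by
          rw [hV]
          gcongr
          exact le_mul_of_one_le_left' (one_le_pow₀ (by norm_num))
  have havg : 3 ^ n * ((⨍⁻ y in Q, ‖f y‖ₑ ^ r ∂volume) ^ (1 / r) *
      (⨍⁻ y in Q, ‖g y‖ₑ ^ s ∂volume) ^ (1 / s)) =
        dyadicAverage r s (fun y => ‖f y‖ₑ) (fun y => ‖g y‖ₑ) j x := by
    rw [setLAverage_eq, setLAverage_eq, ENNReal.div_rpow_of_nonneg _ _ hrs.one_div_nonneg,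
      ENNReal.div_rpow_of_nonneg _ _ hrs.symm.one_div_nonneg,
      ← ENNReal.mul_div_mul_comm (Or.inr (ENNReal.rpow_ne_top_of_nonneg hrs.symm.one_div_nonneg
        hVt)) (Or.inl (ENNReal.rpow_ne_top_of_nonneg hrs.one_div_nonneg hVt)),
      ← ENNReal.rpow_add _ _ hV0 hVt, hrs.one_div_add_one_div, div_one, ENNReal.rpow_one, hV,
      ← mul_div_assoc, ENNReal.mul_div_mul_left _ _ (by positivity) (by finiteness),
      dyadicAverage, normProd]
  calc ((2:ℝ≥0∞) ^ α) ^ j * dyadicAverage r s (fun y => ‖f y‖ₑ) (fun y => ‖g y‖ₑ) j x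
      ≤ volume Q ^ (α / n) * dyadicAverage r s (fun y => ‖f y‖ₑ) (fun y => ‖g y‖ₑ) j x := by
        gcongr
    _ = _ := by
        rw [← havg]
        ring

end

/-! ### Weighted bound for the majorant -/

section

variable {n : ℕ} {α r s : ℝ}

lemma aestronglyMeasurable_integrand {f g : EuclideanSpace ℝ (Fin n) → ℂ} (hf : AEMeasurable f)
    (hg : AEMeasurable g) (x : EuclideanSpace ℝ (Fin n)) :
    AEStronglyMeasurable (integrand α f g x) := by
  have hf' : AEMeasurable fun y => f (x - y) :=
    hf.comp_quasiMeasurePreserving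
      (Measure.measurePreserving_sub_left volume x).quasiMeasurePreserving
  have hg' : AEMeasurable fun y => g (x + y) :=
    hg.comp_quasiMeasurePreserving (measurePreserving_add_left volume x).quasiMeasurePreserving
  have hk : Measurable fun y : EuclideanSpace ℝ (Fin n) => ((‖y‖ ^ ((n : ℝ) - α) : ℝ) : ℂ) :=
    Complex.measurable_ofReal.comp (measurable_norm.pow_const _)
  exact ((hf'.mul hg').div hk.aemeasurable).aestronglyMeasurable

lemma IsWeight.lintegral_weightMeasure {w : EuclideanSpace ℝ (Fin n) → ℝ} (hw : IsWeight w)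
    {h : EuclideanSpace ℝ (Fin n) → ℝ≥0∞} (hh : Measurable h) :
    ∫⁻ x, h x ∂(weightMeasure w) = ∫⁻ x, h x * ENNReal.ofReal (w x) := by
  rw [weightMeasure, lintegral_withDensity_eq_lintegral_mul₀ hw.aemeasurable hh.aemeasurable]
  exact lintegral_congr fun x => mul_comm _ _

/-- The pointwise majorant `D` of the bilinear fractional integral, and its weighted bound. -/
lemma MemAinfty.exists_majorant (hα : 0 < α) (hαn : α < n) {q : ℝ} (hq : 0 < q)
    (hrs : r.HolderConjugate s) {w : EuclideanSpace ℝ (Fin n) → ℝ} (hw : MemAinfty w) :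
    ∃ C : ℝ≥0∞, C ≠ ∞ ∧ ∀ f g : EuclideanSpace ℝ (Fin n) → ℂ, AEMeasurable f → AEMeasurable g →
      ∃ D : EuclideanSpace ℝ (Fin n) → ℝ≥0∞, Measurable D ∧
        (∀ x, ∫⁻ y, ‖integrand α f g x y‖ₑ ≤ D x) ∧
        ∫⁻ x, D x ^ q ∂(weightMeasure w) ≤
          C * ∫⁻ x, maximal α r s f g x ^ q * ENNReal.ofReal (w x) := by
  have hn : n ≠ 0 := by
    rintro rfl
    simp only [Nat.cast_zero] at hαn
    linarith
  have hw' : IsWeight w := by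
    obtain ⟨p, -, hw, -⟩ := hw
    exact hw
  obtain ⟨C, hC, hmain⟩ := hw.exists_lintegral_tsum_dyadicAverage_le hn hq hrs
    (c := 2 ^ α) (ENNReal.one_lt_rpow ENNReal.one_lt_two hα) (by finiteness)
  set K := ENNReal.ofReal (2 ^ ((n : ℝ) - α))
  refine ⟨K ^ q * (C * (3 ^ n) ^ q), by finiteness, fun f g hf hg => ?_⟩
  set b := dyadicAverage r s (fun y => ‖f y‖ₑ) (fun y => ‖g y‖ₑ)
  have hb : ∀ j, Measurable fun x => (2 ^ α) ^ j * b j x := fun j =>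
    ((isDyadic_dyadicAverage r s _ _).measurable j).const_mul _
  have hbsum : Measurable fun x => ∑' j, (2 ^ α) ^ j * b j x := Measurable.tsum hb
  refine ⟨fun x => K * ∑' j, (2 ^ α) ^ j * b j x, hbsum.const_mul K,
    fun x => lintegral_enorm_integrand_le hαn hrs hf hg x, ?_⟩
  simp_rw [ENNReal.mul_rpow_of_nonneg _ _ hq.le]
  rw [lintegral_const_mul _ (hbsum.pow_const q), mul_assoc, mul_assoc]
  gcongr
  refine (hmain _ _ hf.enorm hg.enorm).trans ?_
  gcongr
  have hsup : Measurable fun x => (⨆ j, (2 ^ α) ^ j * b j x) ^ q :=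
    (Measurable.iSup hb).pow_const q
  -- The density is extracted for the measurable dyadic supremum, and the constant is moved by its
  -- finiteness alone, so measurability of the maximal function is never needed.
  rw [hw'.lintegral_weightMeasure hsup, ← lintegral_const_mul' _ _ (by finiteness)]
  refine lintegral_mono fun x => ?_
  rw [← mul_assoc, ← ENNReal.mul_rpow_of_nonneg _ _ hq.le]
  gcongr
  exact iSup_le fun j => zpow_mul_dyadicAverage_le_maximal hn hα hrs f g j x

end

end BilinearFractional

end

theorem mainTheorem4 (n : ℕ) (α q r s : ℝ) (hα : 0 < α) (hαn : α < n) (hq : 0 < q)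
    (hrs : r.HolderConjugate s) (w : EuclideanSpace ℝ (Fin n) → ℝ)
    (hw : BilinearFractional.MemAinfty w) :
    ∃ C : ℝ≥0, ∀ f g : EuclideanSpace ℝ (Fin n) → ℂ,
      AEMeasurable f volume → AEMeasurable g volume →
      ((∫⁻ x, BilinearFractional.maximal α r s f g x ^ q * ENNReal.ofReal (w x)) < ∞ →
        ∀ᵐ x, Integrable (BilinearFractional.integrand α f g x) volume) ∧
      (∫⁻ x, ‖BilinearFractional.BI α f g x‖ₑ ^ q * ENNReal.ofReal (w x)) ≤
        C * ∫⁻ x, BilinearFractional.maximal α r s f g x ^ q * ENNReal.ofReal (w x) := by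
  obtain ⟨C, hC, hmain⟩ := hw.exists_majorant hα hαn hq hrs
  obtain ⟨p, -, hw, -⟩ := hw
  refine ⟨C.toNNReal, fun f g hf hg => ?_⟩
  obtain ⟨D, hDm, hD, hle⟩ := hmain f g hf hg
  rw [ENNReal.coe_toNNReal hC]
  constructor
  · intro hfin
    have hD' : ∀ᵐ x ∂(BilinearFractional.weightMeasure w), D x ^ q < ∞ :=
      ae_lt_top (hDm.pow_const q) (hle.trans_lt (ENNReal.mul_lt_top hC.lt_top hfin)).ne
    -- Positivity of `w` almost everywhere carries finiteness of `D` from weighted-almost every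
    -- point to Lebesgue-almost every point.
    have hac : volume ≪ BilinearFractional.weightMeasure w :=
      withDensity_absolutelyContinuous' hw.aemeasurable
        (hw.pos.mono fun x hx => (ENNReal.ofReal_pos.2 hx).ne')
    filter_upwards [hac.ae_le hD'] with x hx
    refine ⟨BilinearFractional.aestronglyMeasurable_integrand hf hg x, (hD x).trans_lt ?_⟩
    exact (ENNReal.rpow_lt_top_iff_of_pos hq).1 hx
  · refine le_trans ?_ hle
    rw [hw.lintegral_weightMeasure (hDm.pow_const q)]
    gcongr with x
    exact (enorm_integral_le_lintegral_enorm _).trans (hD x)
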